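/- **Setting.** Let $\Omega\subset\mathbb R^3$ be a bounded open set that is the interior of its closure (for example a bounded Lipschitz domain), and let $E_h$ be a finite conforming mesh of $\overline\Omega$ by nondegenerate tetrahedra with maximal diameter $h>0$. Let $a>0$, $\gamma>1$, $p(\varrho)=a\varrho^\gamma$, $\kappa>0$, $\epsilon>\tfrac16$, $T>0$, $\Delta t>0$ and $M\in\mathbb N$ with $M\Delta t=T$. Let $\varrho_0\in L^{\gamma+1}(\Omega)$ with $\varrho_0\ge 0$ a.e. and $m_0\in L^{3/2}(\Omega)^3$. **Notation.** For a face $\Gamma$ shared by two elements $E_-,E_+$, let $\nu$ be the unit normal pointing from $E_-$ to $E_+$ (one of the two choices, fixed once and for all), let $f_\pm$ be the trace on $\Gamma$ from $E_\pm$, and let $[\![f]\!]=f_+-f_-$. Sums $\sum_\Gamma$ run over these interior faces, each counted once. $Q_h$ is the space of scalars that are constant on each element. $V_h$ is the Crouzeix–Raviart space of vector fields $v$ that are affine on each element, with $\int_\Gamma[\![v]\!]\,dS=0$ on every interior face and $\int_\Gamma v\,dS=0$ on every boundary face. $\Pi_h^Q f$ is the elementwise mean of $f$, and $\widehat v=\Pi_h^Qv$.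 $\Pi_h^V w\in V_h$ is the element of $V_h$ with $\int_\Gamma\Pi_h^Vw\,dS=\int_\Gamma w\,dS$ on every interior face. The operators $\nabla_h,\operatorname{div}_h$ are taken elementwise. Write $s^+=\max\{s,0\}$, $s^-=\min\{s,0\}$, and on a face $\Gamma$ $$\operatorname{Up}(\varrho u)=\varrho_-\Big(\tfrac1{|\Gamma|}\int_\Gamma u\cdot\nu\,dS\Big)^{+}+\varrho_+\Big(\tfrac1{|\Gamma|}\int_\Gamma u\cdot\nu\,dS\Big)^{-},\qquad \operatorname{Up}(\varrho u\otimes\widehat u)=\operatorname{Up}(\varrho u)^{+}\,\widehat u_-+\operatorname{Up}(\varrho u)^{-}\,\widehat u_+ .$$ **Scheme.** Given $u_h^0\in V_h$, put $\varrho_h^0=\Pi_h^Q(\varrho_0+\kappa h)$. A numerical solution with initial velocity $u_h^0$ is a family $(\varrho_h^k,u_h^k)\in Q_h\times V_h$, $k=1,\dots,M$, such that for every such $k$, for all $q_h\in Q_h$, $$\int_\Omega\frac{\varrho_h^k-\varrho_h^{k-1}}{\Delta t}q_h\,dx-\sum_\Gamma\int_\Gamma\operatorname{Up}(\varrho^k_h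 u^k_h)[\![q_h]\!]\,dS+h^{1-\epsilon}\sum_\Gamma\int_\Gamma[\![\varrho_h^k]\!][\![q_h]\!]\,dS=0,$$ and for all $v_h\in V_h$, $$\int_\Omega\frac{\varrho_h^k\widehat u_h^k-\varrho_h^{k-1}\widehat u_h^{k-1}}{\Delta t}\cdot v_h\,dx-\sum_\Gamma\int_\Gamma\operatorname{Up}(\varrho_h^ku_h^k\otimes\widehat u_h^k)\cdot[\![\widehat v_h]\!]\,dS+\int_\Omega\nabla_hu_h^k:\nabla_hv_h-p(\varrho_h^k)\operatorname{div}_hv_h\,dx$$ $$\qquad+\,h^{1-\epsilon}\sum_\Gamma\int_\Gamma[\![\varrho_h^k]\!]\,\frac{\widehat u^k_-+\widehat u^k_+}{2}\cdot[\![\widehat v_h]\!]\,dS=0 .$$ **Proposition 3.2.** 1. If $m_0/(\varrho_0+\kappa h)$ is integrable on every interior face, then the interpolant $u_h^0=\Pi_h^V\big[m_0/(\varrho_0+\kappa h)\big]$ exists and there is a numerical solution with this initial velocity such that $\varrho_h^k>0$ on $\Omega$ for all $k=1,\dots,M$. 2. More generally, for every $u_h^0\in V_h$ there is a numerical solution with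 initial velocity $u_h^0$ such that $\varrho_h^k>0$ on $\Omega$ for all $k=1,\dots,M$. -/

import Mathlib

open MeasureTheory

noncomputable section

/-- Three-dimensional Euclidean space. -/
abbrev E3 := EuclideanSpace ℝ (Fin 3)

/-- A finite conforming tetrahedral mesh of (the closure of) a set `Ω ⊆ ℝ³`. The elements are
nondegenerate tetrahedra, pairwise distinct; two of them meet exactly in the convex hull of their
common vertices (nothing, a vertex, an edge or a face); together they fill `closure Ω`. -/
structure TetMesh (Ω : Set E3) where
  /-- the number of elements -/
  card : ℕ
  /-- the elements, listed in an arbitrary order -/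
  elem : Fin card → Affine.Simplex ℝ E3 3
  distinct : ∀ i j, Set.range (elem i).points = Set.range (elem j).points → i = j
  conforming : ∀ i j, (elem i).closedInterior ∩ (elem j).closedInterior =
    convexHull ℝ (Set.range (elem i).points ∩ Set.range (elem j).points)
  iUnion_eq : ⋃ i, (elem i).closedInterior = closure Ω

namespace TetMesh

variable {Ω : Set E3} (𝒯 : TetMesh Ω)

/-- The `i`-th element, as a closed set. -/
def cell (i : Fin 𝒯.card) : Set E3 := (𝒯.elem i).closedInterior

/-- `h` is the maximal diameter of the elements. -/
def IsMeshSize (h : ℝ) : Prop :=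
  IsGreatest (Set.range fun i => Metric.diam (𝒯.cell i)) h

/-! ### Faces -/

/-- A face seen from inside an element: the pair `(i, k)` stands for the face of the `i`-th
element which is opposite to the `k`-th vertex of that element. -/
abbrev LocalFace := Fin 𝒯.card × Fin 4

/-- The closed triangle which a local face occupies. -/
def face (F : 𝒯.LocalFace) : Set E3 := ((𝒯.elem F.1).faceOpposite F.2).closedInterior

/-- The set of the three vertices of a local face. -/
def faceVertices (F : 𝒯.LocalFace) : Set E3 :=
  Set.range ((𝒯.elem F.1).faceOpposite F.2).points

/-- The unit normal to a face which points out of the element. -/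
def outerNormal (F : 𝒯.LocalFace) : E3 :=
  ((𝒯.elem F.1).height F.2)⁻¹ • ((𝒯.elem F.1).altitudeFoot F.2 - (𝒯.elem F.1).points F.2)

open Classical in
/-- The faces shared by two elements. Such a face `Γ` is recorded as the pair of its two sides:
`Γ.1` is the face seen from `E₋` and `Γ.2` is the same face seen from `E₊`. The normal `ν` is fixed
as the one which points from the element with the smaller index, `E₋`, to the one with the larger
index, `E₊`. -/
def interiorFaces : Finset (𝒯.LocalFace × 𝒯.LocalFace) :=
  Finset.univ.filter fun Γ => Γ.1.1 < Γ.2.1 ∧ 𝒯.faceVertices Γ.1 = 𝒯.faceVertices Γ.2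

/-- A boundary face: it is a face of one element only. -/
def IsBoundaryFace (F : 𝒯.LocalFace) : Prop :=
  ∀ G : 𝒯.LocalFace, G.1 ≠ F.1 → 𝒯.faceVertices G ≠ 𝒯.faceVertices F

/-! ### Finite element spaces -/

/-- `Q_h`: piecewise constant scalars, given by their value on each element. -/
abbrev Q := Fin 𝒯.card → ℝ

/-- Vector fields which are affine on each element; `v i` is the restriction to the `i`-th
element, so the two traces on a face `Γ` shared by two elements are `v Γ.1.1` (from `E₋`) and
`v Γ.2.1` (from `E₊`). -/
abbrev P1 := Fin 𝒯.card → (E3 →ᵃ[ℝ] E3)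

/-- `V_h`: the Crouzeix-Raviart space with vanishing degrees of freedom at the boundary. The jump
has mean zero on every interior face, the trace has mean zero on every boundary face; `μHE[2]` is
the two-dimensional surface measure. -/
def V : Set 𝒯.P1 :=
  {v | (∀ Γ ∈ 𝒯.interiorFaces, ∫ x in 𝒯.face Γ.1, (v Γ.2.1 x - v Γ.1.1 x) ∂μHE[2] = 0) ∧
    ∀ F, 𝒯.IsBoundaryFace F → ∫ x in 𝒯.face F, v F.1 x ∂μHE[2] = 0}

/-- `Π_h^Q f` for a scalar function `f`: the mean over each element. -/
def projQ (f : E3 → ℝ) : 𝒯.Q := fun i => ⨍ x in 𝒯.cell i, f x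

/-- `v̂ = Π_h^Q v` for a piecewise affine vector field `v`. -/
def hat (v : 𝒯.P1) : Fin 𝒯.card → E3 := fun i => ⨍ x in 𝒯.cell i, v i x

/-- `v = Π_h^V w`: the element of `V_h` with the same integral as `w` over every interior face. (By
membership in `V_h`, the trace from `E₊` has the same integral as the trace from `E₋`.) -/
def IsInterpolant (w : E3 → E3) (v : 𝒯.P1) : Prop :=
  v ∈ 𝒯.V ∧ ∀ Γ ∈ 𝒯.interiorFaces,
    ∫ x in 𝒯.face Γ.1, v Γ.1.1 x ∂μHE[2] = ∫ x in 𝒯.face Γ.1, w x ∂μHE[2]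

/-- The jump `f₊ - f₋` across an interior face of an elementwise constant function. -/
def jump {X : Type*} [Sub X] (f : Fin 𝒯.card → X) (Γ : 𝒯.LocalFace × 𝒯.LocalFace) : X :=
  f Γ.2.1 - f Γ.1.1

/-- `∇u : ∇v` for affine vector fields. -/
def gradInner (u v : E3 →ᵃ[ℝ] E3) : ℝ :=
  ∑ j : Fin 3, inner ℝ (u.linear (EuclideanSpace.single j 1)) (v.linear (EuclideanSpace.single j 1))

/-- The divergence of an affine vector field. -/
def divergence (v : E3 →ᵃ[ℝ] E3) : ℝ := LinearMap.trace ℝ E3 v.linear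

/-! ### Upwind fluxes -/

/-- `(1/|Γ|) ∫_Γ u · ν dS`. -/
def normalFlux (u : 𝒯.P1) (Γ : 𝒯.LocalFace × 𝒯.LocalFace) : ℝ :=
  ⨍ x in 𝒯.face Γ.1, inner ℝ (u Γ.1.1 x) (𝒯.outerNormal Γ.1) ∂μHE[2]

/-- `Up(ϱu) = ϱ₋ (ũ·ν)⁺ + ϱ₊ (ũ·ν)⁻`, with `f⁺ = max f 0` and `f⁻ = min f 0`. -/
def up (ρ : 𝒯.Q) (u : 𝒯.P1) (Γ : 𝒯.LocalFace × 𝒯.LocalFace) : ℝ :=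
  ρ Γ.1.1 * max (𝒯.normalFlux u Γ) 0 + ρ Γ.2.1 * min (𝒯.normalFlux u Γ) 0

/-- `Up(ϱu ⊗ û) = Up⁺(ϱu) û₋ + Up⁻(ϱu) û₊`. -/
def upMom (ρ : 𝒯.Q) (u : 𝒯.P1) (Γ : 𝒯.LocalFace × 𝒯.LocalFace) : E3 :=
  max (𝒯.up ρ u Γ) 0 • 𝒯.hat u Γ.1.1 + min (𝒯.up ρ u Γ) 0 • 𝒯.hat u Γ.2.1

/-! ### The numerical method -/

/-- The discrete continuity equation: `ρ'` is the density at the old time step, `(ρ, u)` is the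
state at the new one. At boundary faces the flux vanishes and there is no jump, so that the sums run
over the interior faces. -/
def Continuity (h ε Δt : ℝ) (ρ' ρ : 𝒯.Q) (u : 𝒯.P1) : Prop :=
  ∀ q : 𝒯.Q,
    (∑ i, (∫ _x in 𝒯.cell i, (ρ i - ρ' i) / Δt * q i))
      - (∑ Γ ∈ 𝒯.interiorFaces, (∫ _x in 𝒯.face Γ.1, 𝒯.up ρ u Γ * 𝒯.jump q Γ ∂μHE[2]))
      + h ^ (1 - ε) *
        (∑ Γ ∈ 𝒯.interiorFaces, (∫ _x in 𝒯.face Γ.1, 𝒯.jump ρ Γ * 𝒯.jump q Γ ∂μHE[2])) = 0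

/-- The discrete momentum equation with the pressure `p(ϱ) = a ϱ ^ γ`: `(ρ', u')` is the state at
the old time step, `(ρ, u)` is the state at the new one. -/
def Momentum (h ε Δt a γ : ℝ) (ρ' : 𝒯.Q) (u' : 𝒯.P1) (ρ : 𝒯.Q) (u : 𝒯.P1) : Prop :=
  ∀ v ∈ 𝒯.V,
    (∑ i, (∫ x in 𝒯.cell i,
        inner ℝ (Δt⁻¹ • (ρ i • 𝒯.hat u i - ρ' i • 𝒯.hat u' i)) (v i x)))
      - (∑ Γ ∈ 𝒯.interiorFaces, (∫ _x in 𝒯.face Γ.1,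
          inner ℝ (𝒯.upMom ρ u Γ) (𝒯.jump (𝒯.hat v) Γ) ∂μHE[2]))
      + (∑ i, (∫ _x in 𝒯.cell i,
          (gradInner (u i) (v i) - a * ρ i ^ γ * divergence (v i))))
      + h ^ (1 - ε) * (∑ Γ ∈ 𝒯.interiorFaces, (∫ _x in 𝒯.face Γ.1,
          𝒯.jump ρ Γ * inner ℝ ((2 : ℝ)⁻¹ • (𝒯.hat u Γ.1.1 + 𝒯.hat u Γ.2.1))
            (𝒯.jump (𝒯.hat v) Γ) ∂μHE[2])) = 0

/-- `(ρ k, u k)`, `k = 0, …, M`, is a numerical solution with initial state `(ρ⁰, u⁰)`. Only the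
values at `k ≤ M` matter. -/
structure IsNumericalSolution (h ε Δt a γ : ℝ) (M : ℕ) (ρ0 : 𝒯.Q) (u0 : 𝒯.P1)
    (ρ : ℕ → 𝒯.Q) (u : ℕ → 𝒯.P1) : Prop where
  density_zero : ρ 0 = ρ0
  velocity_zero : u 0 = u0
  mem_V : ∀ k, 1 ≤ k → k ≤ M → u k ∈ 𝒯.V
  continuity : ∀ k, 1 ≤ k → k ≤ M → 𝒯.Continuity h ε Δt (ρ (k - 1)) (ρ k) (u k)
  momentum : ∀ k, 1 ≤ k → k ≤ M →
    𝒯.Momentum h ε Δt a γ (ρ (k - 1)) (u (k - 1)) (ρ k) (u k)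

end TetMesh

end

/-!
Each time step is solved by eliminating the density and then finding a zero of a vector field on the
Crouzeix-Raviart space.

For a given velocity `u` the continuity equation is a linear system for the new density. It is of
M-matrix type: testing with the indicator of the set `{ρ ≤ 0}` gives every flux term a sign, so the
system is uniquely solvable and its solution `density u` is positive (`pos_of_transport_eq`,
`density_pos`); it depends continuously on `u`, and conservation of mass bounds it independently of
`u` (`density_le`).

Inserting `density u` into the momentum equation leaves a continuous vector field `F` on the
finite-dimensional space `V_h`. Testing with `u` and subtracting the continuity equation tested with
`|û|² / 2` yields `⟨F u, u⟩ ≥ ∑ |E| (|∇u|² + ρ' |û|² / (2 Δt)) - C ‖u‖` (`energy_le`), where the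
pressure is estimated with the mass bound. Since the old density `ρ'` is positive and an affine map
with zero mean and zero gradient vanishes, the quadratic part is positive definite, so
`⟨F u, u⟩ > 0` on a large sphere, and `F` has a zero (`exists_step`). No Poincaré inequality and no
relation between the normals of adjacent elements is needed.

The existence of the zero is Brouwer's theorem in the form `exists_zero_of_inner_pos`. It follows
from `no_smooth_retraction`, which is proved by the Milnor-Rogers volume argument: if `r` is a
retraction of a ball onto its sphere and `g = r - id`, then `id + t g` is a bijection of the ball
for small `t`, so that `∫ det (1 + t Dg)` is the volume of the ball; this is polynomial in `t`,
hence also true at `t = 1`, where the determinant vanishes.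

For the interpolant, an affine field on a tetrahedron is determined by its integrals over the four
faces, because the mean over a triangle is the mean of the vertex values
(`Affine.Simplex.setIntegral_affineMap`).
-/

/-! ### Brouwer's theorem -/

section Brouwer

open Metric Set Filter Topology MeasureTheory

variable {E : Type*} [NormedAddCommGroup E] [InnerProductSpace ℝ E]

theorem exists_mem_segment_norm_eq {x y : E} {R : ℝ} (hx : ‖x‖ ≤ R) (hy : R ≤ ‖y‖) :
    ∃ z, ‖z‖ = R ∧ dist x z ≤ dist x y := by
  have hc : ContinuousOn (fun s : ℝ => ‖AffineMap.lineMap x y s‖) (Icc 0 1) := by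
    apply Continuous.continuousOn
    exact (AffineMap.lineMap_continuous).norm
  obtain ⟨s, hs, hsR⟩ := intermediate_value_Icc zero_le_one hc
    (show R ∈ Icc _ _ by simpa using ⟨hx, hy⟩)
  refine ⟨_, hsR, ?_⟩
  rw [dist_left_lineMap, Real.norm_of_nonneg hs.1]
  exact mul_le_of_le_one_left dist_nonneg hs.2

/-- A Lipschitz map on a ball which vanishes on the bounding sphere, extended by zero. -/
theorem LipschitzOnWith.indicator_closedBall {g : E → E} {K : NNReal} {R : ℝ}
    (hg : LipschitzOnWith K g (closedBall 0 R)) (h0 : ∀ x, ‖x‖ = R → g x = 0) :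
    LipschitzWith K ((closedBall (0 : E) R).indicator g) := by
  have key : ∀ x y : E, ‖x‖ ≤ R → ¬ ‖y‖ ≤ R → dist (g x) 0 ≤ K * dist x y := by
    intro x y hx hy
    obtain ⟨z, hz, hd⟩ := exists_mem_segment_norm_eq hx (le_of_not_ge hy)
    rw [← h0 z hz]
    refine (hg.dist_le_mul x (by simpa using hx) z (by simp [hz])).trans ?_
    gcongr
  refine LipschitzWith.of_dist_le_mul fun x y => ?_
  by_cases hx : ‖x‖ ≤ R <;> by_cases hy : ‖y‖ ≤ R
  · simpa [indicator, hx, hy] using hg.dist_le_mul x (by simpa using hx) y (by simpa using hy)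
  · simpa [indicator, hx, hy] using key x y hx hy
  · rw [dist_comm, dist_comm x]
    simpa [indicator, hx, hy] using key y x hy hx
  · simp only [indicator, mem_closedBall, dist_zero_right, hx, hy, if_false, dist_self]
    positivity

variable [FiniteDimensional ℝ E]

/-- For fixed `A` the function `t ↦ det (1 + tA)` is a polynomial of degree at most `dim E`. -/
theorem exists_polynomial_det_one_add_smul (A : E →L[ℝ] E) :
    ∃ p : Polynomial ℝ, p.natDegree ≤ Module.finrank ℝ E ∧
      ∀ t : ℝ, (ContinuousLinearMap.id ℝ E + t • A).det = p.eval t := by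
  let b := Module.finBasis ℝ E
  let N := LinearMap.toMatrix b b (A : E →ₗ[ℝ] E)
  refine ⟨Matrix.det ((Polynomial.X : Polynomial ℝ) • N.map Polynomial.C +
    (1 : Matrix _ _ ℝ).map Polynomial.C), ?_, fun t => ?_⟩
  · simpa using Polynomial.natDegree_det_X_add_C_le N 1
  · rw [ContinuousLinearMap.det, ← LinearMap.det_toMatrix b, ← Polynomial.coe_evalRingHom,
      RingHom.map_det]
    congr 1
    ext i j
    simp [N, LinearMap.toMatrix_apply, Matrix.one_apply, Finsupp.single_apply, eq_comm, add_comm]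
    split_ifs <;> simp [mul_comm]

variable [MeasurableSpace E] [BorelSpace E]

/-- For small `t > 0` the map `id + t g` is a bijection of the ball, and the change of variables
formula computes its volume. -/
theorem integral_det_eq_of_small {g : E → E} (hg : ContDiff ℝ 1 g) {R : ℝ}
    (h0 : ∀ x, ‖x‖ = R → g x = 0) :
    ∃ t₀ > 0, ∀ t : ℝ, 0 < t → t < t₀ →
      ∫ x in ball (0 : E) R, (ContinuousLinearMap.id ℝ E + t • fderiv ℝ g x).det
        = volume.real (ball (0 : E) R) := by
  have hcd : Continuous (fderiv ℝ g) := hg.continuous_fderiv one_ne_zero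
  obtain ⟨K, hK⟩ : ∃ K : NNReal, ∀ x ∈ closedBall (0 : E) R, ‖fderiv ℝ g x‖₊ ≤ K := by
    obtain ⟨C, hC⟩ := (isCompact_closedBall (0 : E) R).exists_bound_of_continuousOn
      hcd.continuousOn
    exact ⟨C.toNNReal, fun x hx => by
      rw [← NNReal.coe_le_coe]
      exact (hC x hx).trans (Real.le_coe_toNNReal C)⟩
  have hLip : LipschitzOnWith K g (closedBall 0 R) :=
    (convex_closedBall (0 : E) R).lipschitzOnWith_of_nnnorm_fderiv_le
      (fun x _ => hg.differentiable one_ne_zero x) hK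
  set G := (closedBall (0 : E) R).indicator g with hG
  have hGLip : LipschitzWith K G := hLip.indicator_closedBall h0
  have hdet : ∀ᶠ B in 𝓝 (ContinuousLinearMap.id ℝ E), 0 < B.det := by
    refine ContinuousLinearMap.continuous_det.continuousAt.eventually_const_lt ?_
    simp [ContinuousLinearMap.det]
  obtain ⟨δ, hδ, hdetδ⟩ := Metric.eventually_nhds_iff.1 hdet
  have hK1 : (0 : ℝ) < K + 1 := by positivity
  refine ⟨min 1 δ / (K + 1), by positivity, fun t ht0 ht => ?_⟩
  have htK : t * K < min 1 δ := by
    rw [lt_div_iff₀ hK1] at ht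
    nlinarith
  -- `g` is extended by zero, so that `f` is a Lipschitz perturbation of the
  -- identity on the whole space, hence bijective
  let f : E → E := fun x => x + t • G x
  have hf : ApproximatesLinearOn f (ContinuousLinearEquiv.refl ℝ E : E →L[ℝ] E) univ
      (t.toNNReal * K) := by
    refine fun x _ y _ => ?_
    have : f x - f y - (ContinuousLinearEquiv.refl ℝ E : E →L[ℝ] E) (x - y)
        = t • (G x - G y) := by
      simp only [f, ContinuousLinearEquiv.coe_refl, ContinuousLinearMap.coe_id', id, smul_sub]
      abel
    rw [this, norm_smul, Real.norm_of_nonneg ht0.le, NNReal.coe_mul, Real.coe_toNNReal _ ht0.le,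
      mul_assoc, ← dist_eq_norm, ← dist_eq_norm]
    gcongr
    exact hGLip.dist_le_mul x y
  have hc : Subsingleton E ∨ t.toNNReal * K <
      ‖((ContinuousLinearEquiv.refl ℝ E).symm : E →L[ℝ] E)‖₊⁻¹ := by
    rcases subsingleton_or_nontrivial E with h | h
    · exact Or.inl h
    · right
      rw [← NNReal.coe_lt_coe]
      simpa [ht0.le] using htK.trans_le (min_le_left _ _)
  have hinj : Function.Injective f := injOn_univ.1 (hf.injOn hc)
  have hsurj : Function.Surjective f := hf.surjective hc
  have hout : ∀ x, x ∉ ball (0 : E) R → f x = x := by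
    intro x hx
    simp only [mem_ball, dist_zero_right, not_lt] at hx
    have : G x = 0 := by
      rcases hx.eq_or_lt with h | h
      · simp [hG, indicator, h0 x h.symm]
      · simp [hG, h]
    simp [f, this]
  have himg : f '' ball (0 : E) R = ball (0 : E) R := by
    have h1 : f '' (ball (0 : E) R)ᶜ = (ball (0 : E) R)ᶜ := by
      have : EqOn f id (ball (0 : E) R)ᶜ := fun x hx => hout x hx
      rw [this.image_eq, image_id]
    rw [image_compl_eq ⟨hinj, hsurj⟩] at h1
    exact compl_injective h1
  have hder : ∀ x ∈ ball (0 : E) R, HasFDerivWithinAt f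
      (ContinuousLinearMap.id ℝ E + t • fderiv ℝ g x) (ball 0 R) x := by
    intro x hx
    have h1 : HasFDerivAt (fun x => x + t • g x)
        (ContinuousLinearMap.id ℝ E + t • fderiv ℝ g x) x :=
      (hasFDerivAt_id x).add
        (((hg.differentiable one_ne_zero x).hasFDerivAt).const_smul t)
    refine h1.hasFDerivWithinAt.congr (fun y hy => ?_) ?_
    · simp [f, hG, indicator, (mem_ball_zero_iff.1 hy).le]
    · simp [f, hG, indicator, (mem_ball_zero_iff.1 hx).le]
  have hcv := integral_image_eq_integral_abs_det_fderiv_smul volume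
    (measurableSet_ball (x := (0 : E)) (ε := R)) hder hinj.injOn (fun _ => (1 : ℝ))
  rw [himg] at hcv
  simp only [integral_const, smul_eq_mul, mul_one, measureReal_restrict_apply_univ] at hcv
  rw [hcv]
  refine setIntegral_congr_fun measurableSet_ball fun x hx => ?_
  refine (abs_of_pos (hdetδ ?_)).symm
  rw [dist_eq_norm, add_sub_cancel_left, norm_smul, Real.norm_of_nonneg ht0.le]
  refine lt_of_le_of_lt ?_ (htK.trans_le (min_le_right _ _))
  gcongr
  exact hK x (ball_subset_closedBall hx)

/-- The integral is a polynomial in `t` which is constant for small `t > 0`, hence constant. -/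
theorem integral_det_eq {g : E → E} (hg : ContDiff ℝ 1 g) {R : ℝ}
    (h0 : ∀ x, ‖x‖ = R → g x = 0) (t : ℝ) :
    ∫ x in ball (0 : E) R, (ContinuousLinearMap.id ℝ E + t • fderiv ℝ g x).det
      = volume.real (ball (0 : E) R) := by
  obtain ⟨t₀, ht₀, hsmall⟩ := integral_det_eq_of_small hg h0
  set n := Module.finrank ℝ E
  let s : Finset ℕ := Finset.range (n + 1)
  -- interpolation nodes at which the integral is known; the interpolation weights at `t` do not
  -- depend on `x`, so that integrating the interpolation formula needs no bound on coefficients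
  let v : ℕ → ℝ := fun i => t₀ / (i + 2)
  have hv : InjOn v s := by
    intro i _ j _ hij
    simp only [v, div_eq_mul_inv] at hij
    exact_mod_cast add_right_cancel (inv_injective (mul_left_cancel₀ ht₀.ne' hij))
  have hv0 : ∀ i, 0 < v i := fun i => by positivity
  have hvt : ∀ i, v i < t₀ := fun i => by
    refine div_lt_self ht₀ ?_
    have : (0 : ℝ) ≤ i := i.cast_nonneg
    linarith
  have hcd : Continuous (fderiv ℝ g) := hg.continuous_fderiv one_ne_zero
  have hint : ∀ t : ℝ, IntegrableOn
      (fun x => (ContinuousLinearMap.id ℝ E + t • fderiv ℝ g x).det) (ball (0 : E) R) := by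
    intro t
    refine (Continuous.continuousOn ?_).integrableOn_compact (isCompact_closedBall (0 : E) R)
      |>.mono_set ball_subset_closedBall
    exact ContinuousLinearMap.continuous_det.comp (continuous_const.add (hcd.const_smul t))
  have hinterp : ∀ p : Polynomial ℝ, p.natDegree ≤ n →
      p.eval t = ∑ i ∈ s, p.eval (v i) * (Lagrange.basis s v i).eval t := by
    intro p hp
    have hdeg : p.degree < s.card := by
      rw [Finset.card_range]
      exact lt_of_le_of_lt p.degree_le_natDegree (by exact_mod_cast Nat.lt_succ_of_le hp)
    conv_lhs => rw [Lagrange.eq_interpolate hv hdeg, Lagrange.interpolate_apply]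
    simp [Polynomial.eval_finsetSum]
  have hexp : ∀ x : E, (ContinuousLinearMap.id ℝ E + t • fderiv ℝ g x).det
      = ∑ i ∈ s, (ContinuousLinearMap.id ℝ E + v i • fderiv ℝ g x).det *
        (Lagrange.basis s v i).eval t := by
    intro x
    obtain ⟨p, hp, hpe⟩ := exists_polynomial_det_one_add_smul (fderiv ℝ g x)
    simp only [hpe]
    exact hinterp p hp
  have hone : (1 : ℝ) = ∑ i ∈ s, (Lagrange.basis s v i).eval t := by
    simpa using hinterp 1 (by simp)
  simp_rw [hexp]
  rw [integral_finsetSum _ fun i _ => (hint (v i)).mul_const _]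
  simp_rw [integral_mul_const, hsmall _ (hv0 _) (hvt _)]
  rw [← Finset.mul_sum, ← hone, mul_one]

open scoped InnerProductSpace

/-- There is no `C¹` retraction of a ball onto its bounding sphere; for convenience the map is
defined on the whole space. -/
theorem no_smooth_retraction {r : E → E} (hr : ContDiff ℝ 1 r) {R : ℝ} (hR : 0 < R)
    (hid : ∀ x, ‖x‖ = R → r x = x) (hsphere : ∀ x, ‖r x‖ = R) : False := by
  have hvol := integral_det_eq (g := fun x => r x - x) (hr.sub contDiff_id) (R := R)
    (fun x hx => by simp [hid x hx]) 1
  have hzero : ∀ x, (ContinuousLinearMap.id ℝ E + (1 : ℝ) • fderiv ℝ (fun x => r x - x) x).det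
      = 0 := by
    intro x
    have hrx := hr.differentiable one_ne_zero x
    rw [fderiv_fun_sub hrx differentiableAt_fun_id, fderiv_fun_id, one_smul, add_sub_cancel]
    by_contra hne
    have hsurj : Function.Surjective (fderiv ℝ r x) :=
      (LinearMap.equivOfDetNeZero ((fderiv ℝ r x : E →L[ℝ] E) : E →ₗ[ℝ] E) hne).surjective
    -- `‖r‖` is constant, so the range of the derivative is orthogonal to `r x`
    have horth : ∀ w, ⟪r x, fderiv ℝ r x w⟫_ℝ = 0 := by
      intro w
      have h1 := hrx.hasFDerivAt.norm_sq
      have h2 : (fun y => ‖r y‖ ^ 2) = fun _ => R ^ 2 := by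
        ext y
        rw [hsphere]
      rw [h2] at h1
      have h3 := congrArg (fun L => L w) (h1.unique (hasFDerivAt_const (R ^ 2) x))
      simpa using h3
    obtain ⟨w, hw⟩ := hsurj (r x)
    have h4 := horth w
    rw [hw, inner_self_eq_zero] at h4
    have h5 := hsphere x
    rw [h4, norm_zero] at h5
    exact hR.ne h5
  simp only [hzero, integral_zero] at hvol
  have : 0 < volume.real (ball (0 : E) R) :=
    ENNReal.toReal_pos (measure_ball_pos volume _ hR).ne' measure_ball_lt_top.ne
  exact this.ne hvol

/-- Brouwer's theorem: a continuous vector field which points outwards on a sphere has a zero. If it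
had none, a smooth selection from suitable convex sets would give a nowhere vanishing `C¹` field
`G` with `G x = x` for `2 * R ≤ ‖x‖`, and `2 * R • G / ‖G‖` would be a retraction. -/
theorem exists_zero_of_inner_pos {F : E → E} (hF : Continuous F) {R : ℝ} (hR : 0 < R)
    (hpos : ∀ x, ‖x‖ = R → 0 < ⟪F x, x⟫_ℝ) : ∃ x, F x = 0 := by
  by_contra! hne
  let t : E → Set E := fun x => {y | (‖x‖ ≤ R → 0 < ⟪y, F x⟫_ℝ) ∧ (R ≤ ‖x‖ → 0 < ⟪y, x⟫_ℝ) ∧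
    (2 * R ≤ ‖x‖ → y = x)}
  have ht : ∀ x, Convex ℝ (t x) := by
    intro x y hy z hz a b ha hb hab
    have hcomb : ∀ p q : ℝ, 0 < p → 0 < q → 0 < a * p + b * q := by
      intro p q hp hq
      rcases ha.eq_or_lt with h | h
      · have : b = 1 := by linarith
        simp [← h, this, hq]
      · positivity
    refine ⟨fun h => ?_, fun h => ?_, fun h => ?_⟩
    · rw [inner_add_left, real_inner_smul_left, real_inner_smul_left]
      exact hcomb _ _ (hy.1 h) (hz.1 h)
    · rw [inner_add_left, real_inner_smul_left, real_inner_smul_left]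
      exact hcomb _ _ (hy.2.1 h) (hz.2.1 h)
    · rw [hy.2.2 h, hz.2.2 h, ← add_smul, hab, one_smul]
  have hloc : ∀ x : E, ∃ U ∈ 𝓝 x, ∃ g : E → E,
      ContMDiffOn (modelWithCornersSelf ℝ E) (modelWithCornersSelf ℝ E) (1 : ℕ∞) g U ∧
        ∀ y ∈ U, g y ∈ t y := by
    intro x
    rcases le_or_gt ‖x‖ R with hx | hx
    · have h1 : ∀ᶠ y in 𝓝 x, 0 < ⟪F x, F y⟫_ℝ :=
        (continuous_const.inner hF).continuousAt.eventually_const_lt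
          (real_inner_self_pos.2 (hne x))
      have h2 : ∀ᶠ y in 𝓝 x, R ≤ ‖y‖ → 0 < ⟪F x, y⟫_ℝ := by
        rcases hx.eq_or_lt with h | h
        · exact ((continuous_const.inner continuous_id).continuousAt.eventually_const_lt
            (hpos x h)).mono fun _ hy _ => hy
        · exact (continuous_norm.continuousAt.eventually_lt_const h).mono
            fun y hy hy' => absurd hy hy'.not_gt
      have h3 : ∀ᶠ y in 𝓝 x, ‖y‖ < 2 * R :=
        continuous_norm.continuousAt.eventually_lt_const (by linarith)
      refine ⟨_, h1.and (h2.and h3), fun _ => F x, contMDiffOn_const, fun y hy => ?_⟩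
      exact ⟨fun _ => hy.1, hy.2.1, fun h => absurd hy.2.2 h.not_gt⟩
    · refine ⟨{y | R < ‖y‖}, continuous_norm.continuousAt.eventually_const_lt hx, id,
        contMDiffOn_id, fun y (hy : R < ‖y‖) => ⟨fun h => absurd hy h.not_gt, fun h => ?_,
          fun _ => rfl⟩⟩
      have : y ≠ 0 := norm_pos_iff.1 (hR.trans hy)
      exact real_inner_self_pos.2 this
  obtain ⟨G, hG⟩ := exists_contMDiffMap_forall_mem_convex_of_local
    (modelWithCornersSelf ℝ E) ht hloc
  have hGs : ContDiff ℝ 1 G := contMDiff_iff_contDiff.1 G.contMDiff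
  have hG0 : ∀ x, G x ≠ 0 := by
    intro x h0
    rcases le_total ‖x‖ R with h | h
    · simpa [h0] using (hG x).1 h
    · simpa [h0] using (hG x).2.1 h
  refine no_smooth_retraction (r := fun x => (2 * R / ‖G x‖) • G x) ?_ (R := 2 * R) (by positivity)
    (fun x hx => ?_) fun x => ?_
  · exact (contDiff_const.div (hGs.norm ℝ hG0) fun x => norm_ne_zero_iff.2 (hG0 x)).smul hGs
  · rw [(hG x).2.2 hx.ge, hx, div_self (by positivity), one_smul]
  · have := norm_pos_iff.2 (hG0 x)
    rw [norm_smul, Real.norm_of_nonneg (by positivity), div_mul_cancel₀ _ this.ne']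

end Brouwer

/-! ### Integrals of affine maps over triangles -/

noncomputable section

/-- The triangle with vertices `(0, 0)`, `(1, 0)`, `(0, 1)`. -/
def refTriangle : Set (EuclideanSpace ℝ (Fin 2)) := {x | 0 ≤ x 0 ∧ 0 ≤ x 1 ∧ x 0 + x 1 ≤ 1}

theorem isCompact_refTriangle : IsCompact refTriangle := by
  refine Metric.isCompact_of_isClosed_isBounded ?_ ?_
  · refine IsClosed.inter (s₁ := {x : EuclideanSpace ℝ (Fin 2) | 0 ≤ x 0})
      (s₂ := {x | 0 ≤ x 1 ∧ x 0 + x 1 ≤ 1})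
      (isClosed_le (by fun_prop) (by fun_prop)) ?_
    refine IsClosed.inter (s₁ := {x : EuclideanSpace ℝ (Fin 2) | 0 ≤ x 1})
      (s₂ := {x | x 0 + x 1 ≤ 1})
      (isClosed_le (by fun_prop) (by fun_prop)) (isClosed_le (by fun_prop) (by fun_prop))
  · refine (Metric.isBounded_closedBall (x := 0) (r := 1)).subset fun x hx => ?_
    obtain ⟨h0, h1, h2⟩ := hx
    rw [mem_closedBall_zero_iff, EuclideanSpace.norm_eq, Real.sqrt_le_one, Fin.sum_univ_two]
    simp only [Real.norm_eq_abs, sq_abs]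
    nlinarith

theorem volume_refTriangle_pos : 0 < volume.real refTriangle := by
  refine ENNReal.toReal_pos (ne_of_gt ?_) isCompact_refTriangle.measure_lt_top.ne
  refine lt_of_lt_of_le (b := volume
    ({x | 0 < x 0} ∩ ({x | 0 < x 1} ∩ {x | x 0 + x 1 < 1}) : Set (EuclideanSpace ℝ (Fin 2))))
    ?_ (measure_mono fun x hx => ⟨hx.1.le, hx.2.1.le, hx.2.2.le⟩)
  refine IsOpen.measure_pos _ ?_ ⟨!₂[1/3, 1/3], ?_⟩
  · exact (isOpen_lt (by fun_prop) (by fun_prop)).inter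
      ((isOpen_lt (by fun_prop) (by fun_prop)).inter (isOpen_lt (by fun_prop) (by fun_prop)))
  · norm_num

/-- The barycentric coordinates of the reference triangle. -/
def refCoord (x : EuclideanSpace ℝ (Fin 2)) : Fin 3 → ℝ := ![1 - x 0 - x 1, x 0, x 1]

theorem continuous_refCoord (j : Fin 3) : Continuous fun x => refCoord x j := by
  fin_cases j <;> simp [refCoord] <;> fun_prop

theorem sum_refCoord (x : EuclideanSpace ℝ (Fin 2)) : ∑ j, refCoord x j = 1 := by
  simp only [refCoord, Fin.sum_univ_three, Matrix.cons_val]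
  ring

namespace Affine.Simplex

/-- The linear part of the parametrization of a triangle by the reference triangle. -/
def planeMap (t : Affine.Simplex ℝ E3 2) : EuclideanSpace ℝ (Fin 2) →ₗ[ℝ] E3 :=
  (EuclideanSpace.proj 0 : _ →L[ℝ] ℝ).toLinearMap.smulRight (t.points 1 - t.points 0) +
    (EuclideanSpace.proj 1 : _ →L[ℝ] ℝ).toLinearMap.smulRight (t.points 2 - t.points 0)

theorem planeMap_apply (t : Affine.Simplex ℝ E3 2) (x : EuclideanSpace ℝ (Fin 2)) :
    t.planeMap x = x 0 • (t.points 1 - t.points 0) + x 1 • (t.points 2 - t.points 0) := by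
  simp [planeMap]

theorem planeMap_injective (t : Affine.Simplex ℝ E3 2) : Function.Injective t.planeMap := by
  rw [← LinearMap.ker_eq_bot, LinearMap.ker_eq_bot']
  intro x hx
  let w : Fin 3 → ℝ := ![-(x 0 + x 1), x 0, x 1]
  have hw : ∑ i, w i = 0 := by
    simp only [w, Fin.sum_univ_three, Matrix.cons_val]
    ring
  have hwp : ∑ i, w i • t.points i = 0 := by
    rw [← hx, planeMap_apply]
    simp only [w, Fin.sum_univ_three, Matrix.cons_val]
    module
  have h := affineIndependent_iff.1 t.independent Finset.univ w hw hwp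
  ext i
  fin_cases i
  · simpa [w] using h 1 (Finset.mem_univ _)
  · simpa [w] using h 2 (Finset.mem_univ _)

/-- The parametrization of a triangle by the reference triangle. -/
def param (t : Affine.Simplex ℝ E3 2) (x : EuclideanSpace ℝ (Fin 2)) : E3 :=
  t.points 0 + t.planeMap x

theorem param_eq_sum (t : Affine.Simplex ℝ E3 2) (x : EuclideanSpace ℝ (Fin 2)) :
    t.param x = ∑ j, refCoord x j • t.points j := by
  simp only [param, planeMap_apply, refCoord, Fin.sum_univ_three, Matrix.cons_val]
  module

theorem isClosedEmbedding_param (t : Affine.Simplex ℝ E3 2) :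
    Topology.IsClosedEmbedding t.param :=
  (Homeomorph.addLeft (t.points 0)).isClosedEmbedding.comp
    (LinearMap.isClosedEmbedding_of_injective (LinearMap.ker_eq_bot.2 t.planeMap_injective))

theorem param_image (t : Affine.Simplex ℝ E3 2) : t.param '' refTriangle = t.closedInterior := by
  ext p
  simp only [Affine.Simplex.closedInterior, Affine.Simplex.setInterior, Set.mem_image]
  constructor
  · rintro ⟨x, ⟨h0, h1, h2⟩, rfl⟩
    refine ⟨refCoord x, sum_refCoord x, fun i => ?_, ?_⟩
    · fin_cases i <;> simp [refCoord] <;> constructor <;> linarith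
    · rw [Finset.affineCombination_eq_linear_combination _ _ _ (sum_refCoord x), param_eq_sum]
  · rintro ⟨w, hw, hI, rfl⟩
    have hw' := hw
    rw [Fin.sum_univ_three] at hw'
    refine ⟨!₂[w 1, w 2], ⟨(hI 1).1, (hI 2).1, ?_⟩, ?_⟩
    · have := (hI 0).1
      simp only [Matrix.cons_val]
      linarith
    · rw [Finset.affineCombination_eq_linear_combination _ _ _ hw, param_eq_sum,
        Fin.sum_univ_three, Fin.sum_univ_three]
      simp only [refCoord, Matrix.cons_val]
      congr 3
      linarith

/-- The surface measure on a triangle is the image of a multiple of the Lebesgue measure on the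
reference triangle. -/
theorem restrict_closedInterior_eq_map (t : Affine.Simplex ℝ E3 2) :
    (μHE[2] : Measure E3).restrict t.closedInterior =
      (ENNReal.ofReal t.planeMap.normDet • volume.restrict refTriangle).map t.param := by
  have hme := t.isClosedEmbedding_param.measurableEmbedding
  ext s hs
  rw [Measure.restrict_apply hs, Measure.map_apply hme.measurable hs, Measure.smul_apply,
    Measure.restrict_apply (hme.measurable hs), smul_eq_mul, ← t.param_image,
    ← Set.image_preimage_inter]
  have h1 : ∀ u, t.param '' u = (fun y => t.points 0 + y) '' (t.planeMap '' u) := fun u => by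
    rw [Set.image_image]
    rfl
  have h2 := t.planeMap.euclideanHausdorffMeasure_image_eq_normDet_mul_volume
    (t.param ⁻¹' s ∩ refTriangle)
  rw [finrank_euclideanSpace_fin] at h2
  rw [h1, (isometry_add_left (t.points 0)).euclideanHausdorffMeasure_image, h2]

theorem normDet_planeMap_pos (t : Affine.Simplex ℝ E3 2) : 0 < t.planeMap.normDet := by
  refine lt_of_le_of_ne t.planeMap.normDet_nonneg fun h => ?_
  exact LinearMap.normDet_eq_zero_iff_ker_ne_bot.1 h.symm
    (LinearMap.ker_eq_bot.2 t.planeMap_injective)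

theorem area_eq (t : Affine.Simplex ℝ E3 2) : (μHE[2] : Measure E3) t.closedInterior =
    ENNReal.ofReal t.planeMap.normDet * volume refTriangle := by
  rw [← Measure.restrict_apply_self, restrict_closedInterior_eq_map,
    Measure.map_apply t.isClosedEmbedding_param.continuous.measurable
      t.isClosed_closedInterior.measurableSet, Measure.smul_apply, smul_eq_mul, ← t.param_image,
    Set.preimage_image_eq _ t.isClosedEmbedding_param.injective, Measure.restrict_apply_self]

theorem area_lt_top (t : Affine.Simplex ℝ E3 2) : (μHE[2] : Measure E3) t.closedInterior < ⊤ := by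
  rw [area_eq]
  exact ENNReal.mul_lt_top ENNReal.ofReal_lt_top isCompact_refTriangle.measure_lt_top

theorem real_area_eq (t : Affine.Simplex ℝ E3 2) : (μHE[2] : Measure E3).real t.closedInterior =
    t.planeMap.normDet * volume.real refTriangle := by
  rw [Measure.real, area_eq, ENNReal.toReal_mul, ENNReal.toReal_ofReal t.planeMap.normDet_nonneg]
  rfl

theorem area_pos (t : Affine.Simplex ℝ E3 2) :
    0 < (μHE[2] : Measure E3).real t.closedInterior := by
  rw [real_area_eq]
  exact mul_pos t.normDet_planeMap_pos volume_refTriangle_pos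

theorem setIntegral_affineMap_eq_sum_refCoord (t : Affine.Simplex ℝ E3 2) (g : E3 →ᵃ[ℝ] E3) :
    ∫ x in t.closedInterior, g x ∂μHE[2] =
      ((μHE[2] : Measure E3).real t.closedInterior / volume.real refTriangle) •
        ∑ j, (∫ x in refTriangle, refCoord x j) • g (t.points j) := by
  have hg : ∀ x, g (t.param x) = ∑ j, refCoord x j • g (t.points j) := fun x => by
    rw [param_eq_sum, ← Finset.affineCombination_eq_linear_combination _ _ _ (sum_refCoord x),
      Finset.map_affineCombination _ _ _ (sum_refCoord x),
      Finset.affineCombination_eq_linear_combination _ _ _ (sum_refCoord x)]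
    rfl
  rw [restrict_closedInterior_eq_map, t.isClosedEmbedding_param.measurableEmbedding.integral_map,
    integral_smul_measure, ENNReal.toReal_ofReal t.planeMap.normDet_nonneg, real_area_eq,
    mul_div_cancel_right₀ _ volume_refTriangle_pos.ne']
  congr 1
  simp_rw [hg]
  rw [integral_finsetSum]
  · simp_rw [integral_smul_const]
  · intro j _
    exact (((continuous_refCoord j).smul continuous_const).continuousOn).integrableOn_compact
      isCompact_refTriangle

/-- The mean of an affine map over a triangle is the mean of its values at the vertices. The
parametrization by the reference triangle depends on the order of the vertices; averaging over the
cyclic reorderings makes the weights equal. -/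
theorem setIntegral_affineMap (t : Affine.Simplex ℝ E3 2) (g : E3 →ᵃ[ℝ] E3) :
    ∫ x in t.closedInterior, g x ∂μHE[2] =
      ((μHE[2] : Measure E3).real t.closedInterior / 3) • ∑ i, g (t.points i) := by
  have hK : ∑ j, ∫ x in refTriangle, refCoord x j = volume.real refTriangle := by
    rw [← integral_finsetSum]
    · simp [sum_refCoord]
    · intro j _
      exact (continuous_refCoord j).continuousOn.integrableOn_compact isCompact_refTriangle
  have h : ∀ k : Fin 3, ∫ x in t.closedInterior, g x ∂μHE[2] =
      ((μHE[2] : Measure E3).real t.closedInterior / volume.real refTriangle) •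
        ∑ j, (∫ x in refTriangle, refCoord x j) • g (t.points (j + k)) := fun k => by
    have := setIntegral_affineMap_eq_sum_refCoord (t.reindex (Equiv.addRight k).symm) g
    simpa using this
  have hsum := Finset.sum_congr rfl fun (k : Fin 3) (_ : k ∈ Finset.univ) => h k
  rw [Finset.sum_const, ← Finset.smul_sum, Finset.sum_comm] at hsum
  simp_rw [← Finset.smul_sum] at hsum
  have hrot : ∀ j : Fin 3, ∑ k, g (t.points (j + k)) = ∑ i, g (t.points i) := fun j =>
    Equiv.sum_comp (Equiv.addLeft j) fun i => g (t.points i)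
  simp_rw [hrot, ← Finset.sum_smul, hK, smul_smul,
    div_mul_cancel₀ _ volume_refTriangle_pos.ne'] at hsum
  rw [div_eq_inv_mul, mul_smul, ← hsum, Finset.card_univ, Fintype.card_fin,
    ← Nat.cast_smul_eq_nsmul ℝ, smul_smul]
  norm_num

end Affine.Simplex

end

/-! ### Elements, faces and the discrete spaces -/

noncomputable section

namespace TetMesh

variable {Ω : Set E3} (𝒯 : TetMesh Ω)

theorem isCompact_cell (i : Fin 𝒯.card) : IsCompact (𝒯.cell i) :=
  (𝒯.elem i).isCompact_closedInterior

theorem cell_eq_convexHull (i : Fin 𝒯.card) :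
    𝒯.cell i = convexHull ℝ (Set.range (𝒯.elem i).points) :=
  (𝒯.elem i).convexHull_eq_closedInterior.symm

theorem affineSpan_elem (i : Fin 𝒯.card) :
    affineSpan ℝ (Set.range (𝒯.elem i).points) = ⊤ :=
  (𝒯.elem i).independent.affineSpan_eq_top_iff_card_eq_finrank_add_one.2 (by simp)

/-- The volume of an element. -/
def vol (i : Fin 𝒯.card) : ℝ := volume.real (𝒯.cell i)

theorem vol_pos (i : Fin 𝒯.card) : 0 < 𝒯.vol i := by
  refine ENNReal.toReal_pos (ne_of_gt ?_) (𝒯.isCompact_cell i).measure_lt_top.ne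
  refine (isOpen_interior.measure_pos volume ?_).trans_le
    (measure_mono (interior_subset (s := 𝒯.cell i)))
  rw [cell_eq_convexHull]
  exact interior_convexHull_nonempty_iff_affineSpan_eq_top.2 (𝒯.affineSpan_elem i)

/-- The area of an interior face. -/
def area (Γ : 𝒯.LocalFace × 𝒯.LocalFace) : ℝ := (μHE[2] : Measure E3).real (𝒯.face Γ.1)

theorem area_nonneg (Γ : 𝒯.LocalFace × 𝒯.LocalFace) : 0 ≤ 𝒯.area Γ := measureReal_nonneg

theorem integrableOn_cell (v : E3 →ᵃ[ℝ] E3) (i : Fin 𝒯.card) : IntegrableOn v (𝒯.cell i) :=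
  v.continuous_of_finiteDimensional.continuousOn.integrableOn_compact (𝒯.isCompact_cell i)

theorem isCompact_face (F : 𝒯.LocalFace) : IsCompact (𝒯.face F) :=
  Affine.Simplex.isCompact_closedInterior _

theorem integrableOn_face {X : Type*} [NormedAddCommGroup X] {f : E3 → X} (hf : Continuous f)
    (F : 𝒯.LocalFace) : IntegrableOn f (𝒯.face F) μHE[2] :=
  hf.continuousOn.integrableOn_of_subset_isCompact (𝒯.isCompact_face F)
    (𝒯.isCompact_face F).measurableSet subset_rfl
    (((𝒯.elem F.1).faceOpposite F.2).area_lt_top).ne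

/-- The elementwise mean `v ↦ v̂`, as a linear map. -/
def hatₗ (i : Fin 𝒯.card) : 𝒯.P1 →ₗ[ℝ] E3 where
  toFun v := 𝒯.hat v i
  map_add' v w := by
    simp only [hat, Pi.add_apply, AffineMap.coe_add, setAverage_eq]
    rw [integral_add (𝒯.integrableOn_cell _ i) (𝒯.integrableOn_cell _ i), smul_add]
  map_smul' c v := by
    simp only [hat, Pi.smul_apply, AffineMap.coe_smul, setAverage_eq, integral_smul,
      RingHom.id_apply]
    rw [smul_comm]

@[simp] theorem hatₗ_apply (i : Fin 𝒯.card) (v : 𝒯.P1) : 𝒯.hatₗ i v = 𝒯.hat v i := rfl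

/-- The mean normal flux through a face, as a linear map. -/
def normalFluxₗ (Γ : 𝒯.LocalFace × 𝒯.LocalFace) : 𝒯.P1 →ₗ[ℝ] ℝ where
  toFun v := 𝒯.normalFlux v Γ
  map_add' v w := by
    have h : ∀ u : E3 →ᵃ[ℝ] E3, Continuous fun x => inner ℝ (u x) (𝒯.outerNormal Γ.1) := fun u =>
      u.continuous_of_finiteDimensional.inner continuous_const
    simp only [normalFlux, Pi.add_apply, AffineMap.coe_add, setAverage_eq, inner_add_left]
    rw [integral_add (𝒯.integrableOn_face (h _) _) (𝒯.integrableOn_face (h _) _), smul_add]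
  map_smul' c v := by
    simp only [normalFlux, Pi.smul_apply, AffineMap.coe_smul, setAverage_eq,
      real_inner_smul_left, integral_const_mul, RingHom.id_apply, smul_eq_mul]
    ring

/-- The Crouzeix-Raviart space as a linear subspace of the piecewise affine fields. -/
def VSub : Submodule ℝ 𝒯.P1 where
  carrier := 𝒯.V
  zero_mem' := by simp [V]
  add_mem' := by
    have h := fun (u : E3 →ᵃ[ℝ] E3) F =>
      𝒯.integrableOn_face u.continuous_of_finiteDimensional F
    rintro v w ⟨hv, hv'⟩ ⟨hw, hw'⟩
    refine ⟨fun Γ hΓ => ?_, fun F hF => ?_⟩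
    · have h1 := hv Γ hΓ
      have h2 := hw Γ hΓ
      rw [integral_sub (h _ _) (h _ _)] at h1 h2 ⊢
      simp only [Pi.add_apply, AffineMap.coe_add]
      rw [integral_add (h _ _) (h _ _), integral_add (h _ _) (h _ _), add_sub_add_comm, h1, h2,
        add_zero]
    · simp only [Pi.add_apply, AffineMap.coe_add]
      rw [integral_add (h _ _) (h _ _), hv' F hF, hw' F hF, add_zero]
  smul_mem' := by
    rintro c v ⟨hv, hv'⟩
    refine ⟨fun Γ hΓ => ?_, fun F hF => ?_⟩
    · simp only [Pi.smul_apply, AffineMap.coe_smul, ← smul_sub, integral_smul, hv Γ hΓ, smul_zero]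
    · simp only [Pi.smul_apply, AffineMap.coe_smul, integral_smul, hv' F hF, smul_zero]

instance finiteDimensional_P1 : FiniteDimensional ℝ 𝒯.P1 :=
  have : FiniteDimensional ℝ (E3 →ᵃ[ℝ] E3) :=
    (AffineMap.toConstProdLinearMap (R := ℝ) (k := ℝ) (V1 := E3) (V2 := E3)).symm.finiteDimensional
  inferInstance

/-- A piecewise affine field is determined by its means and its gradients. -/
theorem eq_zero_of_hat_of_linear {v : 𝒯.P1} (h1 : ∀ i, 𝒯.hat v i = 0)
    (h2 : ∀ i, (v i).linear = 0) : v = 0 := by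
  funext i
  obtain ⟨c, hc⟩ : ∃ c, v i = AffineMap.const ℝ E3 c :=
    (AffineMap.linear_eq_zero_iff_exists_const _).1 (h2 i)
  have h3 := h1 i
  simp only [hat, hc, AffineMap.coe_const, setAverage_eq, Function.const_apply, integral_const,
    measureReal_restrict_apply_univ] at h3
  have hv : volume.real (𝒯.cell i) ≠ 0 := (𝒯.vol_pos i).ne'
  rw [smul_smul, inv_mul_cancel₀ hv, one_smul] at h3
  rw [hc, h3]
  rfl

/-! ### The continuity equation -/

/-- The jump of a piecewise constant scalar, as a linear map. -/
def jumpₗ (Γ : 𝒯.LocalFace × 𝒯.LocalFace) : 𝒯.Q →ₗ[ℝ] ℝ :=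
  (LinearMap.proj Γ.2.1 : 𝒯.Q →ₗ[ℝ] ℝ) - (LinearMap.proj Γ.1.1 : 𝒯.Q →ₗ[ℝ] ℝ)

/-- The upwind flux with velocity `u`, as a linear map in the density. -/
def upₗ (u : 𝒯.P1) (Γ : 𝒯.LocalFace × 𝒯.LocalFace) : 𝒯.Q →ₗ[ℝ] ℝ :=
  max (𝒯.normalFlux u Γ) 0 • (LinearMap.proj Γ.1.1 : 𝒯.Q →ₗ[ℝ] ℝ) +
    min (𝒯.normalFlux u Γ) 0 • (LinearMap.proj Γ.2.1 : 𝒯.Q →ₗ[ℝ] ℝ)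

/-- The transport operator of the scheme with velocity `u`, as a bilinear form in the test function
and the density: implicit Euler, upwind flux, and the stabilization with weight `σ`. -/
def transport (σ Δt : ℝ) (u : 𝒯.P1) : 𝒯.Q →ₗ[ℝ] 𝒯.Q →ₗ[ℝ] ℝ :=
  (∑ i, (𝒯.vol i / Δt) • (LinearMap.proj i : 𝒯.Q →ₗ[ℝ] ℝ).smulRight
      (LinearMap.proj i : 𝒯.Q →ₗ[ℝ] ℝ))
    - (∑ Γ ∈ 𝒯.interiorFaces, 𝒯.area Γ • (𝒯.jumpₗ Γ).smulRight (𝒯.upₗ u Γ))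
    + σ • ∑ Γ ∈ 𝒯.interiorFaces, 𝒯.area Γ • (𝒯.jumpₗ Γ).smulRight (𝒯.jumpₗ Γ)

theorem transport_apply (σ Δt : ℝ) (u : 𝒯.P1) (q ρ : 𝒯.Q) :
    𝒯.transport σ Δt u q ρ = (∑ i, 𝒯.vol i / Δt * (q i * ρ i))
      - (∑ Γ ∈ 𝒯.interiorFaces, 𝒯.area Γ * (𝒯.jump q Γ * 𝒯.up ρ u Γ))
      + σ * ∑ Γ ∈ 𝒯.interiorFaces, 𝒯.area Γ * (𝒯.jump q Γ * 𝒯.jump ρ Γ) := by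
  simp only [transport, jumpₗ, upₗ, jump, up, LinearMap.add_apply, LinearMap.sub_apply,
    LinearMap.smul_apply, LinearMap.sum_apply, LinearMap.smulRight_apply, LinearMap.proj_apply,
    smul_eq_mul, mul_comm (ρ _)]

theorem continuity_iff (h ε Δt : ℝ) (ρ' ρ : 𝒯.Q) (u : 𝒯.P1) :
    𝒯.Continuity h ε Δt ρ' ρ u ↔ ∀ q : 𝒯.Q,
      𝒯.transport (h ^ (1 - ε)) Δt u q ρ = ∑ i, q i * (𝒯.vol i / Δt * ρ' i) := by
  refine forall_congr' fun q => ?_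
  rw [transport_apply]
  simp only [integral_const, measureReal_restrict_apply_univ, smul_eq_mul]
  have h1 : ∑ i, volume.real (𝒯.cell i) * ((ρ i - ρ' i) / Δt * q i) =
      ∑ i, 𝒯.vol i / Δt * (q i * ρ i) - ∑ i, q i * (𝒯.vol i / Δt * ρ' i) := by
    rw [← Finset.sum_sub_distrib]
    exact Finset.sum_congr rfl fun i _ => by rw [vol]; ring
  have h2 : ∀ Γ, (μHE[2] : Measure E3).real (𝒯.face Γ.1) * (𝒯.up ρ u Γ * 𝒯.jump q Γ) =
      𝒯.area Γ * (𝒯.jump q Γ * 𝒯.up ρ u Γ) := fun Γ => by rw [area]; ring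
  have h3 : ∀ Γ, (μHE[2] : Measure E3).real (𝒯.face Γ.1) * (𝒯.jump ρ Γ * 𝒯.jump q Γ) =
      𝒯.area Γ * (𝒯.jump q Γ * 𝒯.jump ρ Γ) := fun Γ => by rw [area]; ring
  simp only [h1, h2, h3]
  constructor <;> intro <;> linarith

section Transport

variable {σ Δt : ℝ}

/-- Testing the transport operator with the indicator of a set on which `ρ ≤ 0` and outside of which
`0 ≤ ρ`: the fluxes and the stabilization contribute with a sign. -/
theorem transport_indicator_le (hσ : 0 ≤ σ) (u : 𝒯.P1) {q ρ : 𝒯.Q}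
    (hq : ∀ i, (q i = 1 ∧ ρ i ≤ 0) ∨ (q i = 0 ∧ 0 ≤ ρ i)) :
    𝒯.transport σ Δt u q ρ ≤ ∑ i, 𝒯.vol i / Δt * (q i * ρ i) := by
  rw [transport_apply]
  have h1 : 0 ≤ ∑ Γ ∈ 𝒯.interiorFaces, 𝒯.area Γ * (𝒯.jump q Γ * 𝒯.up ρ u Γ) := by
    refine Finset.sum_nonneg fun Γ _ => mul_nonneg (𝒯.area_nonneg Γ) ?_
    have hp : 0 ≤ max (𝒯.normalFlux u Γ) 0 := le_max_right _ _
    have hm : min (𝒯.normalFlux u Γ) 0 ≤ 0 := min_le_right _ _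
    simp only [jump, up]
    rcases hq Γ.1.1 with ⟨a1, a2⟩ | ⟨a1, a2⟩ <;> rcases hq Γ.2.1 with ⟨b1, b2⟩ | ⟨b1, b2⟩ <;>
      rw [a1, b1] <;> nlinarith
  have h2 : ∑ Γ ∈ 𝒯.interiorFaces, 𝒯.area Γ * (𝒯.jump q Γ * 𝒯.jump ρ Γ) ≤ 0 := by
    refine Finset.sum_nonpos fun Γ _ => mul_nonpos_of_nonneg_of_nonpos (𝒯.area_nonneg Γ) ?_
    simp only [jump]
    rcases hq Γ.1.1 with ⟨a1, a2⟩ | ⟨a1, a2⟩ <;> rcases hq Γ.2.1 with ⟨b1, b2⟩ | ⟨b1, b2⟩ <;>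
      rw [a1, b1] <;> linarith
  have h3 := mul_nonpos_of_nonneg_of_nonpos hσ h2
  linarith

/-- The transport operator is inverse positive. -/
theorem pos_of_transport_eq (hσ : 0 ≤ σ) (hΔt : 0 < Δt) {u : 𝒯.P1} {ρ b : 𝒯.Q} (hb : ∀ i, 0 < b i)
    (h : ∀ q, 𝒯.transport σ Δt u q ρ = ∑ i, q i * b i) (i : Fin 𝒯.card) : 0 < ρ i := by
  classical
  by_contra! hi
  let q : 𝒯.Q := fun j => if ρ j ≤ 0 then 1 else 0
  have hle := 𝒯.transport_indicator_le (Δt := Δt) hσ u (q := q) (ρ := ρ) fun j => by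
    by_cases hj : ρ j ≤ 0
    · exact Or.inl ⟨if_pos hj, hj⟩
    · exact Or.inr ⟨if_neg hj, (not_le.1 hj).le⟩
  have h1 : ∑ j, 𝒯.vol j / Δt * (q j * ρ j) ≤ 0 := by
    refine Finset.sum_nonpos fun j _ => ?_
    refine mul_nonpos_of_nonneg_of_nonpos (div_pos (𝒯.vol_pos j) hΔt).le ?_
    by_cases hj : ρ j ≤ 0 <;> simp [q, hj]
  have h2 : 0 < ∑ j, q j * b j := by
    refine Finset.sum_pos' (fun j _ => ?_) ⟨i, Finset.mem_univ i, ?_⟩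
    · by_cases hj : ρ j ≤ 0 <;> simp [q, hj, (hb j).le]
    · simp [q, hi, hb i]
  rw [h] at hle
  linarith

theorem nonneg_of_transport_eq_zero (hσ : 0 ≤ σ) (hΔt : 0 < Δt) {u : 𝒯.P1} {ρ : 𝒯.Q}
    (h : ∀ q, 𝒯.transport σ Δt u q ρ = 0) (i : Fin 𝒯.card) : 0 ≤ ρ i := by
  classical
  by_contra! hi
  let q : 𝒯.Q := fun j => if ρ j < 0 then 1 else 0
  have hle := 𝒯.transport_indicator_le (Δt := Δt) hσ u (q := q) (ρ := ρ) fun j => by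
    by_cases hj : ρ j < 0
    · exact Or.inl ⟨if_pos hj, hj.le⟩
    · exact Or.inr ⟨if_neg hj, not_lt.1 hj⟩
  have h1 : ∑ j, 𝒯.vol j / Δt * (q j * ρ j) < 0 := by
    refine Finset.sum_neg' (fun j _ => ?_) ⟨i, Finset.mem_univ i, ?_⟩
    · refine mul_nonpos_of_nonneg_of_nonpos (div_pos (𝒯.vol_pos j) hΔt).le ?_
      by_cases hj : ρ j < 0
      · simp [q, hj, hj.le]
      · simp [q, hj]
    · refine mul_neg_of_pos_of_neg (div_pos (𝒯.vol_pos i) hΔt) ?_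
      simp [q, hi]
  rw [h] at hle
  linarith

open Matrix in
theorem transport_eq_dotProduct (u : 𝒯.P1) (q ρ : 𝒯.Q) : 𝒯.transport σ Δt u q ρ =
    q ⬝ᵥ (LinearMap.toMatrix₂' ℝ (𝒯.transport σ Δt u) *ᵥ ρ) := by
  rw [← Matrix.toLinearMap₂'_apply', Matrix.toLinearMap₂'_toMatrix']

open Matrix in
/-- Unique solvability: a solution of the homogeneous system and its negative are both
nonnegative. -/
theorem det_transport_ne_zero (hσ : 0 ≤ σ) (hΔt : 0 < Δt) (u : 𝒯.P1) :
    (LinearMap.toMatrix₂' ℝ (𝒯.transport σ Δt u)).det ≠ 0 := by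
  intro hdet
  obtain ⟨ρ, hρ, hM⟩ := Matrix.exists_mulVec_eq_zero_iff.2 hdet
  have h : ∀ q, 𝒯.transport σ Δt u q ρ = 0 := fun q => by
    rw [transport_eq_dotProduct, hM, dotProduct_zero]
  refine hρ (funext fun i => le_antisymm ?_ (𝒯.nonneg_of_transport_eq_zero hσ hΔt h i))
  have := 𝒯.nonneg_of_transport_eq_zero hσ hΔt (ρ := -ρ) (fun q => by rw [map_neg, h, neg_zero]) i
  simpa using this

/-- The density at the new time step as a function of the new velocity `u` and the old density. -/
def density (σ Δt : ℝ) (ρ' : 𝒯.Q) (u : 𝒯.P1) : 𝒯.Q :=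
  (LinearMap.toMatrix₂' ℝ (𝒯.transport σ Δt u))⁻¹.mulVec fun i => 𝒯.vol i / Δt * ρ' i

open Matrix in
theorem transport_density (hσ : 0 ≤ σ) (hΔt : 0 < Δt) (ρ' : 𝒯.Q) (u : 𝒯.P1) (q : 𝒯.Q) :
    𝒯.transport σ Δt u q (𝒯.density σ Δt ρ' u) = ∑ i, q i * (𝒯.vol i / Δt * ρ' i) := by
  rw [transport_eq_dotProduct, density, mulVec_mulVec,
    Matrix.mul_nonsing_inv _ (𝒯.det_transport_ne_zero hσ hΔt u).isUnit, one_mulVec]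
  rfl

theorem density_pos (hσ : 0 ≤ σ) (hΔt : 0 < Δt) {ρ' : 𝒯.Q} (hρ' : ∀ i, 0 < ρ' i) (u : 𝒯.P1)
    (i : Fin 𝒯.card) : 0 < 𝒯.density σ Δt ρ' u i :=
  𝒯.pos_of_transport_eq hσ hΔt
    (fun j => mul_pos (div_pos (𝒯.vol_pos j) hΔt) (hρ' j)) (𝒯.transport_density hσ hΔt ρ' u) i

/-- Conservation of mass bounds the density on each element, uniformly in the velocity. -/
theorem density_le (hσ : 0 ≤ σ) (hΔt : 0 < Δt) {ρ' : 𝒯.Q} (hρ' : ∀ i, 0 < ρ' i) (u : 𝒯.P1)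
    (i : Fin 𝒯.card) : 𝒯.density σ Δt ρ' u i ≤ (∑ j, 𝒯.vol j * ρ' j) / 𝒯.vol i := by
  -- the test function `1` has no jumps
  have h := 𝒯.transport_density hσ hΔt ρ' u 1
  rw [transport_apply] at h
  simp only [jump, Pi.one_apply, sub_self, zero_mul, mul_zero, Finset.sum_const_zero, sub_zero,
    add_zero, one_mul, div_mul_eq_mul_div] at h
  rw [← Finset.sum_div, ← Finset.sum_div, div_left_inj' hΔt.ne'] at h
  rw [le_div_iff₀ (𝒯.vol_pos i), mul_comm, ← h]
  exact Finset.single_le_sum (f := fun j => 𝒯.vol j * 𝒯.density σ Δt ρ' u j)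
    (fun j _ => (mul_pos (𝒯.vol_pos j) (𝒯.density_pos hσ hΔt hρ' u j)).le) (Finset.mem_univ i)

theorem continuous_density {X : Type*} [TopologicalSpace X] {U : X → 𝒯.P1}
    (hU : ∀ Γ, Continuous fun x => 𝒯.normalFlux (U x) Γ) (hσ : 0 ≤ σ) (hΔt : 0 < Δt) (ρ' : 𝒯.Q) :
    Continuous fun x => 𝒯.density σ Δt ρ' (U x) := by
  have hM : Continuous fun x => LinearMap.toMatrix₂' ℝ (𝒯.transport σ Δt (U x)) := by
    refine continuous_matrix fun i j => ?_
    simp only [LinearMap.toMatrix₂'_apply, transport_apply, up]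
    have := hU
    fun_prop
  unfold density
  refine Continuous.matrix_mulVec ?_ continuous_const
  simp only [Matrix.inv_def, Ring.inverse_eq_inv']
  exact (hM.matrix_det.inv₀ fun x => 𝒯.det_transport_ne_zero hσ hΔt (U x)).smul hM.matrix_adjugate

end Transport

end TetMesh

end

/-! ### The momentum equation and one time step -/

noncomputable section

section Coercive

open scoped InnerProductSpace

variable {E : Type*} [NormedAddCommGroup E] [InnerProductSpace ℝ E] [FiniteDimensional ℝ E]

/-- A functional bounded below by a positive definite quadratic part minus a part of degree one is
positive on a large sphere. -/
theorem exists_pos_on_sphere {f q l : E → ℝ} (hq : Continuous q) (hl : Continuous l)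
    (hq2 : ∀ (c : ℝ) x, q (c • x) = c ^ 2 * q x) (hl1 : ∀ (c : ℝ) x, 0 ≤ c → l (c • x) = c * l x)
    (hq0 : ∀ x, x ≠ 0 → 0 < q x) (hf : ∀ x, q x - l x ≤ f x) :
    ∃ R > 0, ∀ x, ‖x‖ = R → 0 < f x := by
  have hS : IsCompact (Metric.sphere (0 : E) 1) := isCompact_sphere 0 1
  rcases (Metric.sphere (0 : E) 1).eq_empty_or_nonempty with he | hne
  · refine ⟨1, one_pos, fun x hx => ?_⟩
    have : x ∈ Metric.sphere (0 : E) 1 := by simpa using hx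
    simp [he] at this
  obtain ⟨x₀, hx₀, hmin⟩ := hS.exists_isMinOn hne hq.continuousOn
  obtain ⟨C, hC⟩ := hS.exists_bound_of_continuousOn hl.continuousOn
  have hc : 0 < q x₀ := hq0 x₀ (ne_zero_of_mem_unit_sphere ⟨x₀, hx₀⟩)
  have hR : 0 < (|C| + 1) / q x₀ := by positivity
  refine ⟨(|C| + 1) / q x₀, hR, fun x hx => ?_⟩
  set R := (|C| + 1) / q x₀ with hRdef
  have hRc : R * q x₀ = |C| + 1 := div_mul_cancel₀ _ hc.ne'
  obtain ⟨y, hy, rfl⟩ : ∃ y ∈ Metric.sphere (0 : E) 1, R • y = x := by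
    refine ⟨R⁻¹ • x, ?_, smul_inv_smul₀ hR.ne' x⟩
    rw [mem_sphere_zero_iff_norm, norm_smul, hx, norm_inv, Real.norm_of_nonneg hR.le,
      inv_mul_cancel₀ hR.ne']
  refine lt_of_lt_of_le ?_ (hf _)
  rw [hq2, hl1 _ _ hR.le]
  have h1 : q x₀ ≤ q y := hmin hy
  have h2 : l y ≤ |C| := (le_abs_self _).trans ((hC y hy).trans (le_abs_self C))
  have h3 : R * q x₀ ≤ R * q y := by gcongr
  have h4 : 0 < R * (R * q y - l y) := mul_pos hR (by linarith)
  nlinarith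

/-- The vector in `ℝⁿ` which represents a linear form. -/
theorem inner_toLp_single {n : ℕ} (L : EuclideanSpace ℝ (Fin n) →ₗ[ℝ] ℝ)
    (y : EuclideanSpace ℝ (Fin n)) :
    ⟪(WithLp.toLp 2 fun j => L (EuclideanSpace.single j 1) : EuclideanSpace ℝ (Fin n)), y⟫_ℝ
      = L y := by
  have hy : y = ∑ j, y j • EuclideanSpace.single j (1 : ℝ) := by
    simpa using ((EuclideanSpace.basisFun (Fin n) ℝ).sum_repr y).symm
  conv_rhs => rw [hy, map_sum]
  rw [PiLp.inner_apply]
  exact Finset.sum_congr rfl fun j _ => by simp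

end Coercive

namespace TetMesh

variable {Ω : Set E3} (𝒯 : TetMesh Ω)

/-- The gradient of the restriction to the `i`-th element, as a linear map. -/
def gradₗ (i : Fin 𝒯.card) : 𝒯.P1 →ₗ[ℝ] (E3 →ₗ[ℝ] E3) where
  toFun v := (v i).linear
  map_add' _ _ := rfl
  map_smul' _ _ := rfl

/-- The elementwise divergence, as a linear map. -/
def divₗ (i : Fin 𝒯.card) : 𝒯.P1 →ₗ[ℝ] ℝ := LinearMap.trace ℝ E3 ∘ₗ 𝒯.gradₗ i

theorem divₗ_apply (i : Fin 𝒯.card) (v : 𝒯.P1) : 𝒯.divₗ i v = divergence (v i) := rfl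

/-- The map `v ↦ ∇u : ∇v` on the `i`-th element. -/
def gradInnerₗ (u : 𝒯.P1) (i : Fin 𝒯.card) : 𝒯.P1 →ₗ[ℝ] ℝ :=
  ∑ j : Fin 3, innerₗ E3 ((u i).linear (EuclideanSpace.single j 1)) ∘ₗ
    LinearMap.applyₗ (EuclideanSpace.single j (1 : ℝ)) ∘ₗ 𝒯.gradₗ i

theorem gradInnerₗ_apply (u : 𝒯.P1) (i : Fin 𝒯.card) (v : 𝒯.P1) :
    𝒯.gradInnerₗ u i v = gradInner (u i) (v i) := by
  simp [gradInnerₗ, gradInner, gradₗ]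

/-- The jump of the elementwise mean, as a linear map. -/
def jumpHatₗ (Γ : 𝒯.LocalFace × 𝒯.LocalFace) : 𝒯.P1 →ₗ[ℝ] E3 := 𝒯.hatₗ Γ.2.1 - 𝒯.hatₗ Γ.1.1

/-- The left-hand side of the momentum equation, as a linear form in the test function. -/
def momentumForm (σ Δt a γ : ℝ) (ρ' : 𝒯.Q) (u' : 𝒯.P1) (ρ : 𝒯.Q) (u : 𝒯.P1) : 𝒯.P1 →ₗ[ℝ] ℝ :=
  (∑ i, 𝒯.vol i • innerₗ E3 (Δt⁻¹ • (ρ i • 𝒯.hat u i - ρ' i • 𝒯.hat u' i)) ∘ₗ 𝒯.hatₗ i)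
    - (∑ Γ ∈ 𝒯.interiorFaces, 𝒯.area Γ • innerₗ E3 (𝒯.upMom ρ u Γ) ∘ₗ 𝒯.jumpHatₗ Γ)
    + (∑ i, 𝒯.vol i • (𝒯.gradInnerₗ u i - (a * ρ i ^ γ) • 𝒯.divₗ i))
    + σ • ∑ Γ ∈ 𝒯.interiorFaces, 𝒯.area Γ • (𝒯.jump ρ Γ •
        innerₗ E3 ((2 : ℝ)⁻¹ • (𝒯.hat u Γ.1.1 + 𝒯.hat u Γ.2.1)) ∘ₗ 𝒯.jumpHatₗ Γ)

theorem momentumForm_apply (σ Δt a γ : ℝ) (ρ' : 𝒯.Q) (u' : 𝒯.P1) (ρ : 𝒯.Q) (u v : 𝒯.P1) :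
    𝒯.momentumForm σ Δt a γ ρ' u' ρ u v =
      (∑ i, 𝒯.vol i * inner ℝ (Δt⁻¹ • (ρ i • 𝒯.hat u i - ρ' i • 𝒯.hat u' i)) (𝒯.hat v i))
      - (∑ Γ ∈ 𝒯.interiorFaces,
          𝒯.area Γ * inner ℝ (𝒯.upMom ρ u Γ) (𝒯.jump (𝒯.hat v) Γ))
      + (∑ i, 𝒯.vol i * (gradInner (u i) (v i) - a * ρ i ^ γ * divergence (v i)))
      + σ * ∑ Γ ∈ 𝒯.interiorFaces, 𝒯.area Γ * (𝒯.jump ρ Γ *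
          inner ℝ ((2 : ℝ)⁻¹ • (𝒯.hat u Γ.1.1 + 𝒯.hat u Γ.2.1)) (𝒯.jump (𝒯.hat v) Γ)) := by
  simp only [momentumForm, LinearMap.add_apply, LinearMap.sub_apply, LinearMap.smul_apply,
    LinearMap.sum_apply, LinearMap.comp_apply, innerₗ_apply_apply, smul_eq_mul, hatₗ_apply,
    jumpHatₗ, gradInnerₗ_apply, divₗ_apply, jump]

theorem momentum_iff (h ε Δt a γ : ℝ) (ρ' : 𝒯.Q) (u' : 𝒯.P1) (ρ : 𝒯.Q) (u : 𝒯.P1) :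
    𝒯.Momentum h ε Δt a γ ρ' u' ρ u ↔
      ∀ v ∈ 𝒯.V, 𝒯.momentumForm (h ^ (1 - ε)) Δt a γ ρ' u' ρ u v = 0 := by
  refine forall₂_congr fun v _ => ?_
  have h1 : ∀ (i : Fin 𝒯.card) (c : E3), ∫ x in 𝒯.cell i, inner ℝ c (v i x) =
      𝒯.vol i * inner ℝ c (𝒯.hat v i) := fun i c => by
    have hv : volume.real (𝒯.cell i) ≠ 0 := (𝒯.vol_pos i).ne'
    rw [integral_inner (𝒯.integrableOn_cell (v i) i), hat, setAverage_eq, real_inner_smul_right,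
      vol, mul_inv_cancel_left₀ hv]
  rw [momentumForm_apply]
  simp only [h1, integral_const, measureReal_restrict_apply_univ, smul_eq_mul, vol, area]

variable {σ Δt a γ : ℝ}

/-- The energy estimate: in the momentum equation tested with `u` minus the continuity equation
tested with `|û|² / 2`, the convective terms have a sign and the stabilization cancels. The kinetic
energy is bounded below through the old density. -/
theorem energy_le (hΔt : 0 < Δt) {ρ' ρ : 𝒯.Q} (hρ : ∀ i, 0 ≤ ρ i)
    (hρ' : ∀ i, 0 ≤ ρ' i) (u' u : 𝒯.P1)
    (hc : ∀ q, 𝒯.transport σ Δt u q ρ = ∑ i, q i * (𝒯.vol i / Δt * ρ' i)) :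
    (∑ i, 𝒯.vol i * (gradInner (u i) (u i) + ρ' i / (2 * Δt) * ‖𝒯.hat u i‖ ^ 2)) -
      (∑ i, 𝒯.vol i * (ρ' i / Δt * (‖𝒯.hat u' i‖ * ‖𝒯.hat u i‖) + a * ρ i ^ γ * divergence (u i)))
      ≤ 𝒯.momentumForm σ Δt a γ ρ' u' ρ u u := by
  have hq := hc fun i => ‖𝒯.hat u i‖ ^ 2 / 2
  rw [transport_apply] at hq
  rw [momentumForm_apply]
  have hjump : ∀ Γ : 𝒯.LocalFace × 𝒯.LocalFace,
      inner ℝ ((2 : ℝ)⁻¹ • (𝒯.hat u Γ.1.1 + 𝒯.hat u Γ.2.1)) (𝒯.jump (𝒯.hat u) Γ) =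
        𝒯.jump (fun i => ‖𝒯.hat u i‖ ^ 2 / 2) Γ := fun Γ => by
    simp only [jump, inner_smul_left, inner_add_left, inner_sub_right, real_inner_self_eq_norm_sq,
      real_inner_comm (𝒯.hat u Γ.1.1) (𝒯.hat u Γ.2.1), conj_trivial]
    ring
  have hstab : ∑ Γ ∈ 𝒯.interiorFaces, 𝒯.area Γ * (𝒯.jump ρ Γ *
      inner ℝ ((2 : ℝ)⁻¹ • (𝒯.hat u Γ.1.1 + 𝒯.hat u Γ.2.1)) (𝒯.jump (𝒯.hat u) Γ)) =
      ∑ Γ ∈ 𝒯.interiorFaces,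
        𝒯.area Γ * (𝒯.jump (fun i => ‖𝒯.hat u i‖ ^ 2 / 2) Γ * 𝒯.jump ρ Γ) :=
    Finset.sum_congr rfl fun Γ _ => by rw [hjump, mul_comm (𝒯.jump ρ Γ)]
  have hconv : ∑ Γ ∈ 𝒯.interiorFaces, 𝒯.area Γ * inner ℝ (𝒯.upMom ρ u Γ) (𝒯.jump (𝒯.hat u) Γ) ≤
      ∑ Γ ∈ 𝒯.interiorFaces,
        𝒯.area Γ * (𝒯.jump (fun i => ‖𝒯.hat u i‖ ^ 2 / 2) Γ * 𝒯.up ρ u Γ) := by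
    refine Finset.sum_le_sum fun Γ _ => mul_le_mul_of_nonneg_left ?_ (𝒯.area_nonneg Γ)
    have hsq : 0 ≤ ‖𝒯.hat u Γ.2.1 - 𝒯.hat u Γ.1.1‖ ^ 2 := sq_nonneg _
    rw [norm_sub_sq_real] at hsq
    simp only [upMom, jump, inner_add_left, inner_smul_left, inner_sub_right,
      real_inner_self_eq_norm_sq, real_inner_comm (𝒯.hat u Γ.2.1) (𝒯.hat u Γ.1.1), conj_trivial]
    rcases le_total 0 (𝒯.up ρ u Γ) with h | h
    · rw [max_eq_left h, min_eq_right h]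
      nlinarith
    · rw [max_eq_right h, min_eq_left h]
      nlinarith
  have htime : ∑ i, 𝒯.vol i / Δt * (‖𝒯.hat u i‖ ^ 2 / 2 * ρ i) -
        ∑ i, ‖𝒯.hat u i‖ ^ 2 / 2 * (𝒯.vol i / Δt * ρ' i) +
        ∑ i, 𝒯.vol i * (ρ' i / (2 * Δt) * ‖𝒯.hat u i‖ ^ 2) -
        ∑ i, 𝒯.vol i * (ρ' i / Δt * (‖𝒯.hat u' i‖ * ‖𝒯.hat u i‖)) ≤
      ∑ i, 𝒯.vol i * inner ℝ (Δt⁻¹ • (ρ i • 𝒯.hat u i - ρ' i • 𝒯.hat u' i)) (𝒯.hat u i) := by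
    rw [← Finset.sum_sub_distrib, ← Finset.sum_add_distrib, ← Finset.sum_sub_distrib]
    refine Finset.sum_le_sum fun i _ => ?_
    have hcs := real_inner_le_norm (𝒯.hat u' i) (𝒯.hat u i)
    have hv : 0 ≤ 𝒯.vol i / Δt := (div_pos (𝒯.vol_pos i) hΔt).le
    simp only [inner_smul_left, inner_sub_left, real_inner_self_eq_norm_sq, conj_trivial]
    have h1 : 0 ≤ 𝒯.vol i / Δt * (ρ' i * (‖𝒯.hat u' i‖ * ‖𝒯.hat u i‖ -
        inner ℝ (𝒯.hat u' i) (𝒯.hat u i)) + ρ i * ‖𝒯.hat u i‖ ^ 2 / 2) :=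
      mul_nonneg hv (add_nonneg (mul_nonneg (hρ' i) (sub_nonneg.2 hcs))
        (by have := hρ i; positivity))
    refine le_of_sub_nonneg (h1.trans_eq ?_)
    field_simp
    ring
  rw [hstab]
  simp only [mul_add, mul_sub, Finset.sum_add_distrib, Finset.sum_sub_distrib] at *
  linarith

theorem gradInner_self_nonneg (v : E3 →ᵃ[ℝ] E3) : 0 ≤ gradInner v v :=
  Finset.sum_nonneg fun _ _ => real_inner_self_nonneg

theorem linear_eq_zero_of_gradInner_self_eq_zero {v : E3 →ᵃ[ℝ] E3} (h : gradInner v v = 0) :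
    v.linear = 0 := by
  have h1 := (Finset.sum_eq_zero_iff_of_nonneg fun _ _ => real_inner_self_nonneg).1 h
  refine (EuclideanSpace.basisFun (Fin 3) ℝ).toBasis.ext fun j => ?_
  simpa using h1 j (Finset.mem_univ j)

/-- One time step of the scheme: the density is a function of the velocity, and the remaining
equation for the velocity is solved by Brouwer's theorem on the space `V_h`. -/
theorem exists_step (hσ : 0 ≤ σ) (hΔt : 0 < Δt) (ha : 0 < a) (hγ : 0 < γ) {ρ' : 𝒯.Q}
    (hρ' : ∀ i, 0 < ρ' i) (u' : 𝒯.P1) :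
    ∃ ρ : 𝒯.Q, ∃ u ∈ 𝒯.V, (∀ i, 0 < ρ i) ∧
      (∀ q, 𝒯.transport σ Δt u q ρ = ∑ i, q i * (𝒯.vol i / Δt * ρ' i)) ∧
      ∀ v ∈ 𝒯.V, 𝒯.momentumForm σ Δt a γ ρ' u' ρ u v = 0 := by
  let n := Module.finrank ℝ 𝒯.VSub
  let E := EuclideanSpace ℝ (Fin n)
  let e₀ : E ≃ₗ[ℝ] 𝒯.VSub := LinearEquiv.ofFinrankEq _ _ (by simp [E, n])
  let e : E →ₗ[ℝ] 𝒯.P1 := 𝒯.VSub.subtype ∘ₗ e₀.toLinearMap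
  have he : Function.Injective e := 𝒯.VSub.subtype_injective.comp e₀.injective
  have hflux : ∀ Γ, Continuous fun x => 𝒯.normalFlux (e x) Γ := fun Γ =>
    (𝒯.normalFluxₗ Γ ∘ₗ e).continuous_of_finiteDimensional
  have hhat : ∀ i, Continuous fun x => 𝒯.hat (e x) i := fun i =>
    (𝒯.hatₗ i ∘ₗ e).continuous_of_finiteDimensional
  have hdiv : ∀ i, Continuous fun x => divergence (e x i) := fun i =>
    (𝒯.divₗ i ∘ₗ e).continuous_of_finiteDimensional
  have hgrad : ∀ i (w : E3), Continuous fun x => (e x i).linear w := fun i w =>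
    (LinearMap.applyₗ w ∘ₗ 𝒯.gradₗ i ∘ₗ e).continuous_of_finiteDimensional
  let R : E → 𝒯.Q := fun x => 𝒯.density σ Δt ρ' (e x)
  have hR : Continuous R := 𝒯.continuous_density hflux hσ hΔt ρ'
  have hRi : ∀ i, Continuous fun x => R x i := fun i => (continuous_apply i).comp hR
  have hRpow : ∀ i, Continuous fun x => R x i ^ γ := fun i =>
    (hRi i).rpow_const fun _ => Or.inr hγ.le
  let F : E → E := fun x => WithLp.toLp 2 fun j =>
    𝒯.momentumForm σ Δt a γ ρ' u' (R x) (e x) (e (EuclideanSpace.single j 1))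
  have hFinner : ∀ x y, inner ℝ (F x) y =
      𝒯.momentumForm σ Δt a γ ρ' u' (R x) (e x) (e y) := by
    intro x y
    exact inner_toLp_single (𝒯.momentumForm σ Δt a γ ρ' u' (R x) (e x) ∘ₗ e) y
  have hFc : Continuous F := by
    refine (PiLp.continuous_toLp 2 _).comp (continuous_pi fun j => ?_)
    simp only [momentumForm_apply, upMom, up, gradInner, jump]
    fun_prop
  -- the bound of the density given by conservation of mass
  let P : Fin 𝒯.card → ℝ := fun i => (∑ j, 𝒯.vol j * ρ' j) / 𝒯.vol i
  obtain ⟨r, hr, hpos⟩ := exists_pos_on_sphere (E := E)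
    (f := fun x => inner ℝ (F x) x)
    (q := fun x => ∑ i, 𝒯.vol i * (gradInner (e x i) (e x i) +
      ρ' i / (2 * Δt) * ‖𝒯.hat (e x) i‖ ^ 2))
    (l := fun x => ∑ i, 𝒯.vol i * (ρ' i / Δt * (‖𝒯.hat u' i‖ * ‖𝒯.hat (e x) i‖) +
      a * P i ^ γ * |divergence (e x i)|))
    (by simp only [gradInner]; fun_prop) (by fun_prop)
    (fun c x => by
      have h1 : ∀ i, 𝒯.hat (e (c • x)) i = c • 𝒯.hat (e x) i := fun i => by
        rw [map_smul]; exact (𝒯.hatₗ i).map_smul c _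
      have h2 : ∀ i, gradInner (e (c • x) i) (e (c • x) i) =
          c ^ 2 * gradInner (e x i) (e x i) := fun i => by
        simp only [gradInner, map_smul, Pi.smul_apply, AffineMap.smul_linear, LinearMap.smul_apply,
          real_inner_smul_left, real_inner_smul_right, Finset.mul_sum]
        exact Finset.sum_congr rfl fun _ _ => by ring
      simp only [h1, h2, norm_smul, mul_pow, Real.norm_eq_abs, sq_abs, Finset.mul_sum]
      exact Finset.sum_congr rfl fun _ _ => by ring)
    (fun c x hc => by
      have h1 : ∀ i, 𝒯.hat (e (c • x)) i = c • 𝒯.hat (e x) i := fun i => by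
        rw [map_smul]; exact (𝒯.hatₗ i).map_smul c _
      have h2 : ∀ i, divergence (e (c • x) i) = c * divergence (e x i) := fun i => by
        rw [map_smul]; exact (𝒯.divₗ i).map_smul c _
      simp only [h1, h2, norm_smul, abs_mul, Real.norm_of_nonneg hc, abs_of_nonneg hc,
        Finset.mul_sum]
      exact Finset.sum_congr rfl fun _ _ => by ring)
    (fun x hx => by
      have hterm : ∀ i, 0 ≤ 𝒯.vol i * (gradInner (e x i) (e x i) +
          ρ' i / (2 * Δt) * ‖𝒯.hat (e x) i‖ ^ 2) := fun i => by
        have := hρ' i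
        have := gradInner_self_nonneg (e x i)
        have := 𝒯.vol_pos i
        positivity
      refine (Finset.sum_nonneg fun i _ => hterm i).lt_of_ne fun h0 => hx (he ?_)
      rw [map_zero]
      have h1 := (Finset.sum_eq_zero_iff_of_nonneg fun i _ => hterm i).1 h0.symm
      have h2 : ∀ i, gradInner (e x i) (e x i) = 0 ∧
          ρ' i / (2 * Δt) * ‖𝒯.hat (e x) i‖ ^ 2 = 0 := fun i => by
        have := hρ' i
        refine (add_eq_zero_iff_of_nonneg (gradInner_self_nonneg _) (by positivity)).1 ?_
        exact (mul_eq_zero.1 (h1 i (Finset.mem_univ i))).resolve_left (𝒯.vol_pos i).ne'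
      refine 𝒯.eq_zero_of_hat_of_linear (fun i => ?_) fun i =>
        linear_eq_zero_of_gradInner_self_eq_zero (h2 i).1
      have h3 : ρ' i / (2 * Δt) ≠ 0 := (div_pos (hρ' i) (by positivity)).ne'
      simpa using (mul_eq_zero.1 (h2 i).2).resolve_left h3)
    (fun x => by
      rw [hFinner]
      refine le_trans ?_ (𝒯.energy_le hΔt (fun i => (𝒯.density_pos hσ hΔt hρ' _ i).le)
        (fun i => (hρ' i).le) u' (e x) (𝒯.transport_density hσ hΔt ρ' (e x)))
      refine sub_le_sub_left (Finset.sum_le_sum fun i _ => ?_) _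
      refine mul_le_mul_of_nonneg_left (add_le_add_right ?_ _) (𝒯.vol_pos i).le
      have h0 := (𝒯.density_pos hσ hΔt hρ' (e x) i).le
      refine (mul_le_mul_of_nonneg_left (le_abs_self _)
        (mul_nonneg ha.le (Real.rpow_nonneg h0 _))).trans ?_
      gcongr
      exact 𝒯.density_le hσ hΔt hρ' (e x) i)
  obtain ⟨x, hx⟩ := exists_zero_of_inner_pos hFc hr hpos
  refine ⟨R x, e x, (e₀ x).2, 𝒯.density_pos hσ hΔt hρ' (e x),
    𝒯.transport_density hσ hΔt ρ' (e x), fun v hv => ?_⟩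
  have h1 := hFinner x (e₀.symm ⟨v, hv⟩)
  rw [hx, inner_zero_left] at h1
  rw [h1]
  simp [e]

/-! ### The Crouzeix-Raviart interpolant -/

/-- On a tetrahedron the integrals of an affine map over the four faces can be prescribed. -/
theorem exists_affineMap_setIntegral_face (i : Fin 𝒯.card) (d : Fin 4 → E3) :
    ∃ v : E3 →ᵃ[ℝ] E3, ∀ k, ∫ x in 𝒯.face (i, k), v x ∂μHE[2] = d k := by
  let s := 𝒯.elem i
  let b : AffineBasis (Fin 4) ℝ E3 := ⟨s.points, s.independent, 𝒯.affineSpan_elem i⟩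
  let A : Fin 4 → ℝ := fun k => (μHE[2] : Measure E3).real (𝒯.face (i, k))
  have hA : ∀ k, A k ≠ 0 := fun k => ((s.faceOpposite k).area_pos).ne'
  -- `c k` is the value prescribed at the barycentre of the `k`-th face; the vertex values `y j`
  -- solve `(∑ j ≠ k, y j) / 3 = c k`
  let c : Fin 4 → E3 := fun k => (A k)⁻¹ • d k
  let y : Fin 4 → E3 := fun j => ∑ k, c k - (3 : ℝ) • c j
  let v : E3 →ᵃ[ℝ] E3 :=
    { toFun := fun x => ∑ j, b.coord j x • y j
      linear := ∑ j, (b.coord j).linear.smulRight (y j)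
      map_vadd' := fun x w => by
        have h : ∀ j, b.coord j (w + x) = (b.coord j).linear w + b.coord j x := fun j =>
          (b.coord j).map_vadd x w
        simp only [vadd_eq_add, h, add_smul, Finset.sum_add_distrib, LinearMap.sum_apply,
          LinearMap.smulRight_apply] }
  have hv : ∀ j, v (s.points j) = y j := fun j => by
    have hb : s.points j = b j := rfl
    simp [v, hb, AffineBasis.coord_apply]
  refine ⟨v, fun k => ?_⟩
  have h := (s.faceOpposite k).setIntegral_affineMap v
  refine h.trans ?_
  have hp : ∀ j : Fin 3, (s.faceOpposite k).points j = s.points (k.succAbove j) := fun j =>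
    s.faceOpposite_point_eq_point_succAbove k j
  have hsum : ∑ j : Fin 3, v ((s.faceOpposite k).points j) = (3 : ℝ) • c k := by
    simp_rw [hp, hv]
    have h1 : ∑ j, y j = ∑ j : Fin 4, c j := by
      simp only [y, Finset.sum_sub_distrib, Finset.sum_const, Finset.card_univ, Fintype.card_fin,
        ← Finset.smul_sum]
      module
    have h2 := Fin.sum_univ_succAbove y k
    rw [h1] at h2
    have h3 : y k = ∑ j, c j - (3 : ℝ) • c k := rfl
    rw [h3] at h2
    exact (sub_eq_iff_eq_add'.2 h2).symm.trans (by abel)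
  refine (congrArg _ hsum).trans ?_
  change (A k / 3) • (3 : ℝ) • (A k)⁻¹ • d k = d k
  rw [smul_smul, smul_smul, div_mul_cancel₀ _ (three_ne_zero), mul_inv_cancel₀ (hA k), one_smul]

theorem face_eq_of_faceVertices_eq {F G : 𝒯.LocalFace} (h : 𝒯.faceVertices F = 𝒯.faceVertices G) :
    𝒯.face F = 𝒯.face G := by
  rw [face, face, ← Affine.Simplex.convexHull_eq_closedInterior,
    ← Affine.Simplex.convexHull_eq_closedInterior]
  exact congrArg _ h

theorem not_isBoundaryFace_of_mem_interiorFaces {Γ : 𝒯.LocalFace × 𝒯.LocalFace}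
    (hΓ : Γ ∈ 𝒯.interiorFaces) : ¬ 𝒯.IsBoundaryFace Γ.1 ∧ ¬ 𝒯.IsBoundaryFace Γ.2 := by
  obtain ⟨hlt, heq⟩ := (Finset.mem_filter.1 hΓ).2
  exact ⟨fun h => h Γ.2 hlt.ne' heq.symm, fun h => h Γ.1 hlt.ne heq⟩

/-- Only the cells are matched one by one: a prescribed integral depends on the face as a set of
vertices, so the two traces on an interior face automatically agree in the mean. -/
theorem exists_isInterpolant (w : E3 → E3) : ∃ v, 𝒯.IsInterpolant w v := by
  classical
  let d : 𝒯.LocalFace → E3 := fun F =>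
    if 𝒯.IsBoundaryFace F then 0 else ∫ x in 𝒯.face F, w x ∂μHE[2]
  choose v hv using fun i => 𝒯.exists_affineMap_setIntegral_face i fun k => d (i, k)
  have hd : ∀ F : 𝒯.LocalFace, ∫ x in 𝒯.face F, v F.1 x ∂μHE[2] = d F := fun F => hv F.1 F.2
  have hint : ∀ Γ ∈ 𝒯.interiorFaces, ∫ x in 𝒯.face Γ.1, v Γ.1.1 x ∂μHE[2] =
      ∫ x in 𝒯.face Γ.1, w x ∂μHE[2] := fun Γ hΓ => by
    rw [hd]
    exact if_neg (𝒯.not_isBoundaryFace_of_mem_interiorFaces hΓ).1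
  refine ⟨v, ⟨fun Γ hΓ => ?_, fun F hF => (hd F).trans (if_pos hF)⟩, hint⟩
  have hface : 𝒯.face Γ.1 = 𝒯.face Γ.2 :=
    𝒯.face_eq_of_faceVertices_eq (Finset.mem_filter.1 hΓ).2.2
  rw [integral_sub (𝒯.integrableOn_face (v _).continuous_of_finiteDimensional _)
    (𝒯.integrableOn_face (v _).continuous_of_finiteDimensional _), hint Γ hΓ, hface, hd,
    sub_eq_zero]
  exact if_neg (𝒯.not_isBoundaryFace_of_mem_interiorFaces hΓ).2

/-! ### The initial density and the time iteration -/

/-- Up to a null set an element lies in `Ω`: its interior does, since `Ω` is the interior of its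
closure, and the frontier of a convex set is null. -/
theorem cell_ae_le (hΩ : interior (closure Ω) = Ω) (i : Fin 𝒯.card) :
    𝒯.cell i ≤ᵐ[volume] Ω := by
  have hconv : Convex ℝ (𝒯.cell i) := by
    rw [cell_eq_convexHull]
    exact convex_convexHull ℝ _
  have hsub : 𝒯.cell i ⊆ closure Ω := by
    rw [← 𝒯.iUnion_eq]
    exact Set.subset_iUnion (fun j => (𝒯.elem j).closedInterior) i
  have hint : interior (𝒯.cell i) ⊆ Ω := by
    conv_rhs => rw [← hΩ]
    exact interior_mono hsub
  have hnull : ∀ᵐ x, x ∉ frontier (𝒯.cell i) :=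
    measure_eq_zero_iff_ae_notMem.1 (hconv.addHaar_frontier volume)
  filter_upwards [hnull] with x hx hxi
  by_contra hxΩ
  exact hx ⟨subset_closure hxi, fun h => hxΩ (hint h)⟩

theorem projQ_pos (hΩ : interior (closure Ω) = Ω) {ρ₀ : E3 → ℝ} {c : ℝ} (hc : 0 < c)
    (hint : IntegrableOn ρ₀ Ω) (hnonneg : ∀ᵐ x ∂volume.restrict Ω, 0 ≤ ρ₀ x) (i : Fin 𝒯.card) :
    0 < 𝒯.projQ (fun x => ρ₀ x + c) i := by
  have hle : volume.restrict (𝒯.cell i) ≤ volume.restrict Ω :=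
    Measure.restrict_mono_ae (𝒯.cell_ae_le hΩ i)
  have h1 : IntegrableOn ρ₀ (𝒯.cell i) := Integrable.mono_measure hint hle
  have h2 : 0 ≤ ∫ x in 𝒯.cell i, ρ₀ x := integral_nonneg_of_ae (ae_mono hle hnonneg)
  have hfin : volume (𝒯.cell i) ≠ ⊤ := (𝒯.isCompact_cell i).measure_lt_top.ne
  have hv : 0 < volume.real (𝒯.cell i) := 𝒯.vol_pos i
  rw [projQ, setAverage_eq, integral_add h1 (integrableOn_const hfin), smul_eq_mul, integral_const,
    measureReal_restrict_apply_univ, smul_eq_mul]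
  positivity

theorem exists_isNumericalSolution {h ε Δt a γ : ℝ} (hh : 0 < h) (hΔt : 0 < Δt) (ha : 0 < a)
    (hγ : 0 < γ) (M : ℕ) {ρ0 : 𝒯.Q} (hρ0 : ∀ i, 0 < ρ0 i) (u0 : 𝒯.P1) :
    ∃ (ρ : ℕ → 𝒯.Q) (u : ℕ → 𝒯.P1), 𝒯.IsNumericalSolution h ε Δt a γ M ρ0 u0 ρ u ∧
      ∀ k, 1 ≤ k → k ≤ M → ∀ i, 0 < ρ k i := by
  have hσ : 0 ≤ h ^ (1 - ε) := Real.rpow_nonneg hh.le _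
  let S := {s : 𝒯.Q × 𝒯.P1 // ∀ i, 0 < s.1 i}
  have hstep : ∀ s : S, ∃ s' : S, s'.1.2 ∈ 𝒯.V ∧ 𝒯.Continuity h ε Δt s.1.1 s'.1.1 s'.1.2 ∧
      𝒯.Momentum h ε Δt a γ s.1.1 s.1.2 s'.1.1 s'.1.2 := by
    rintro ⟨⟨ρ', u'⟩, hρ'⟩
    obtain ⟨ρ, u, hu, hρ, hc, hm⟩ := 𝒯.exists_step hσ hΔt ha hγ hρ' u'
    exact ⟨⟨(ρ, u), hρ⟩, hu, (𝒯.continuity_iff ..).2 hc, (𝒯.momentum_iff ..).2 hm⟩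
  choose next hV hC hM using hstep
  let s : ℕ → S := fun k => Nat.rec ⟨(ρ0, u0), hρ0⟩ (fun _ => next) k
  have hs : ∀ k, 1 ≤ k → s k = next (s (k - 1)) := fun k hk => by
    obtain ⟨j, rfl⟩ := Nat.exists_eq_add_of_le' hk
    rfl
  refine ⟨fun k => (s k).1.1, fun k => (s k).1.2, ⟨rfl, rfl, fun k hk _ => ?_, fun k hk _ => ?_,
    fun k hk _ => ?_⟩, fun k _ _ => (s k).2⟩
  · simp only [hs k hk]
    exact hV _
  · simp only [hs k hk]
    exact hC _
  · simp only [hs k hk]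
    exact hM _

end TetMesh

end

theorem proposition3p2
    (Ω : Set E3) (hΩ_open : IsOpen Ω) (hΩ_bounded : Bornology.IsBounded Ω)
    (hΩ_regular : interior (closure Ω) = Ω)
    (𝒯 : TetMesh Ω) (h : ℝ) (hh : 0 < h) (hh_size : 𝒯.IsMeshSize h)
    (a γ κ ε T Δt : ℝ) (M : ℕ) (ha : 0 < a) (hγ : 1 < γ) (hκ : 0 < κ) (hε : 1 / 6 < ε)
    (hT : 0 < T) (hΔt : 0 < Δt) (hM : M * Δt = T)
    (ρ₀ : E3 → ℝ) (m₀ : E3 → E3)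
    (hρ₀ : MemLp ρ₀ (ENNReal.ofReal (γ + 1)) (volume.restrict Ω))
    (hρ₀_nonneg : ∀ᵐ x ∂volume.restrict Ω, 0 ≤ ρ₀ x)
    (hm₀ : MemLp m₀ (3 / 2) (volume.restrict Ω)) :
    -- existence for the initial velocity `Π_h^V [m₀ / (ϱ₀ + κh)]`, when it is defined
    ((∀ Γ ∈ 𝒯.interiorFaces,
        IntegrableOn (fun x => (ρ₀ x + κ * h)⁻¹ • m₀ x) (𝒯.face Γ.1) μHE[2]) →
      ∃ (u0 : 𝒯.P1) (ρ : ℕ → 𝒯.Q) (u : ℕ → 𝒯.P1),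
        𝒯.IsInterpolant (fun x => (ρ₀ x + κ * h)⁻¹ • m₀ x) u0 ∧
        𝒯.IsNumericalSolution h ε Δt a γ M (𝒯.projQ fun x => ρ₀ x + κ * h) u0 ρ u ∧
        ∀ k, 1 ≤ k → k ≤ M → ∀ i, 0 < ρ k i) ∧
    -- existence for any discrete initial velocity
    (∀ u0 ∈ 𝒯.V, ∃ (ρ : ℕ → 𝒯.Q) (u : ℕ → 𝒯.P1),
        𝒯.IsNumericalSolution h ε Δt a γ M (𝒯.projQ fun x => ρ₀ x + κ * h) u0 ρ u ∧
        ∀ k, 1 ≤ k → k ≤ M → ∀ i, 0 < ρ k i) := by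
  have hfin : IsFiniteMeasure (volume.restrict Ω) :=
    ⟨by simpa using hΩ_bounded.measure_lt_top⟩
  have hint : IntegrableOn ρ₀ Ω :=
    hρ₀.integrable (ENNReal.one_le_ofReal.2 (by linarith))
  have hpos : ∀ i, 0 < 𝒯.projQ (fun x => ρ₀ x + κ * h) i :=
    𝒯.projQ_pos hΩ_regular (mul_pos hκ hh) hint hρ₀_nonneg
  have hγ0 : 0 < γ := by linarith
  refine ⟨fun _ => ?_, fun u0 _ => 𝒯.exists_isNumericalSolution hh hΔt ha hγ0 M hpos u0⟩
  obtain ⟨u0, hu0⟩ := 𝒯.exists_isInterpolant fun x => (ρ₀ x + κ * h)⁻¹ • m₀ x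
  obtain ⟨ρ, u, hsol⟩ := 𝒯.exists_isNumericalSolution (ε := ε) hh hΔt ha hγ0 M hpos u0
  exact ⟨u0, ρ, u, hu0, hsol⟩
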